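/- Let $\{X_t\}_{t\in\mathbb Z}$ be a strictly stationary time series in $\mathbb R^d$, let $\|\cdot\|$ be a norm on $\mathbb R^d$, and write $\overline{\mathbb R}=[-\infty,\infty]$. Assume that $\{X_t\}$ is regularly varying: there are $\kappa>0$ and, for every $h\ge 0$, a nonzero Radon measure $\mu_h^*$ on $\overline{\mathbb R}^{(h+1)d}\setminus\{0\}$ with $\mu^*_h(tC)=t^{-\kappa}\mu^*_h(C)$ for all $t>0$ and Borel $C$, such that $$\frac{P\big(x^{-1}(X_0,\dots,X_h)\in\cdot\big)}{P(\|X_0\|>x)}\to\mu_h^*\quad\text{vaguely on }\overline{\mathbb R}^{(h+1)d}\setminus\{0\},\qquad x\to\infty.$$ Let $\mu_0=\mu_0^*$ and, for $h\ge1$, let $\mu_h$ be the image of $\mu_h^*$ under $(s_0,\dots,s_h)\mapsto(s_0,s_h)$, restricted to $\overline{\mathbb R}^{2d}\setminus\{0\}$. Assume that $\{X_t\}$ is $\alpha$-mixing, that is, $\alpha_h\to0$ where $\alpha_h=\sup|P(A\cap B)-P(A)P(B)|$ over $A\in\sigma(X_s,s\le0)$ and $B\in\sigma(X_s,s\ge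 h)$. Let $r_n\to\infty$ and $p_n=P(\|X_0\|>r_n)$, and assume condition (M): $p_n^{-1}=o(n^{1/3})$, and there are integers $l_n\to\infty$ with $l_np_n\to0$ such that (i) $p_n^{-\delta}\sum_{h=l_n}^\infty\alpha_h^\delta\to0$ for some $\delta\in(0,1)$; (ii) $\displaystyle\lim_{h\to\infty}\limsup_{n\to\infty}\frac1{p_n}\sum_{j=h}^{l_n}P(\|X_0\|>r_n,\|X_j\|>r_n)=0$; (iii) $np_n\alpha_{l_n}\to0$. Let $f_1,f_2:\overline{\mathbb R}^d\to\mathbb R$ be bounded measurable functions that vanish on the open unit ball $\{x\in\mathbb R^d:\|x\|<1\}$ and whose sets of discontinuity points are $\mu_0$-null. Assume also that, for all large $n$, $f_i(X_0/r_n)=0$ almost surely on the event $\{\|X_0\|=r_n\}$, $i=1,2$ (for example, $f_i$ vanishes on the unit sphere, or $P(\|X_0\|=r_n)=0$). Set $$S_n^{(i)}=\sum_{t=1}^n\Big(f_i(X_t/r_n)-E f_i(X_0/r_n)\Big),\qquad i=1,2.$$ Then $$\frac1{\sqrt{np_n}}\big(S_n^{(1)},S_n^{(2)}\big)^T\stackrel{d}{\to}N(0,\Sigma),\qquad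 \Sigma=[\sigma^2(f_i,f_j)]_{i,j=1,2},$$ where $$\sigma^2(f_i,f_j)=\sigma_0^2(f_i,f_j)+2\sum_{h=1}^\infty\sigma_h^2(f_i,f_j),\qquad \sigma_0^2(f_i,f_j)=\int f_if_j\,d\mu_0,$$ $$\sigma^2_h(f_i,f_j)=\int\frac{f_i(x)f_j(y)+f_j(x)f_i(y)}2\,\mu_h(dx,dy),\quad h\ge1.$$ All these integrals exist, the series converge, and $\Sigma$ is positive semidefinite. In particular, $$\frac1{np_n}\big(S_n^{(1)},S_n^{(2)}\big)^T\stackrel{P}{\to}0.$$ -/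

import Mathlib

open MeasureTheory ProbabilityTheory Filter Topology Asymptotics
open scoped ENNReal

noncomputable section

namespace MixingTail

/-- The compactified space `[-∞, ∞]^d`. -/
abbrev ExtSpace (d : ℕ) : Type := Fin d → EReal

/-- The vector `x / r`, seen as a point of `[-∞, ∞]^d`. -/
def scaled {d : ℕ} (r : ℝ) (x : Fin d → ℝ) : ExtSpace d :=
  fun j => ((x j / r : ℝ) : EReal)

section Series

variable {Ω : Type*} [MeasurableSpace Ω] {d : ℕ}

/-- Strict stationarity: the law of the whole path is invariant under every time shift. -/
def IsStationary (P : Measure Ω) (X : ℤ → Ω → Fin d → ℝ) : Prop :=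
  ∀ k : ℤ, P.map (fun ω t => X (t + k) ω) = P.map (fun ω t => X t ω)

/-- The `α`-mixing coefficient at lag `h`: the supremum of `|P(A ∩ B) - P(A) P(B)|` over
`A ∈ σ(X_s, s ≤ 0)` and `B ∈ σ(X_s, s ≥ h)`. -/
def mixingCoeff (P : Measure Ω) (X : ℤ → Ω → Fin d → ℝ) (h : ℕ) : ℝ :=
  sSup {a : ℝ | ∃ A B : Set Ω,
    MeasurableSet[⨆ s : {s : ℤ // s ≤ 0}, MeasurableSpace.comap (X s) inferInstance] A ∧
    MeasurableSet[⨆ s : {s : ℤ // (h : ℤ) ≤ s}, MeasurableSpace.comap (X s) inferInstance] B ∧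
    a = |P.real (A ∩ B) - P.real A * P.real B|}

/-- `P(‖X_0‖ > x)`, where the norm on `ℝ^d` is `N`. -/
def tailProb (P : Measure Ω) (N : Seminorm ℝ (Fin d → ℝ)) (X : ℤ → Ω → Fin d → ℝ) (x : ℝ) : ℝ :=
  P.real {ω | x < N (X 0 ω)}

/-- The time series `X` is regularly varying with index `κ > 0`, and `μ h` is the limit measure of
the block `(X_0, …, X_h)`: a nonzero Radon measure on `[-∞, ∞]^{(h+1)d} \ {0}`, homogeneous of
order `-κ`, to which `P((X_0, …, X_h) / x ∈ ·) / P(‖X_0‖ > x)` converges vaguely on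
`[-∞, ∞]^{(h+1)d} \ {0}` as `x → ∞`.  Since `[-∞, ∞]^{(h+1)d}` is compact, the continuous
functions with compact support in `[-∞, ∞]^{(h+1)d} \ {0}` are the continuous functions on
`[-∞, ∞]^{(h+1)d}` that vanish near `0`. -/
structure IsRegularlyVarying (P : Measure Ω) (N : Seminorm ℝ (Fin d → ℝ))
    (X : ℤ → Ω → Fin d → ℝ) (κ : ℝ) (μ : ∀ h : ℕ, Measure (Fin (h + 1) → ExtSpace d)) :
    Prop where
  index_pos : 0 < κ
  ne_zero : ∀ h, μ h ≠ 0
  no_mass_at_zero : ∀ h, μ h {0} = 0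
  finite_away : ∀ h, ∀ U ∈ 𝓝 (0 : Fin (h + 1) → ExtSpace d), μ h Uᶜ < ∞
  homogeneous : ∀ h, ∀ t : ℝ, 0 < t → ∀ C : Set (Fin (h + 1) → ExtSpace d), MeasurableSet C →
    μ h ((fun s i j => (t : EReal) * s i j) '' C) = ENNReal.ofReal (t ^ (-κ)) * μ h C
  tendsto : ∀ h, ∀ φ : (Fin (h + 1) → ExtSpace d) → ℝ, Continuous φ →
    (∀ᶠ s in 𝓝 (0 : Fin (h + 1) → ExtSpace d), φ s = 0) →
    Tendsto
      (fun x : ℝ =>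
        (∫ ω, φ (fun i => scaled x (X ((i : ℕ) : ℤ) ω)) ∂P) / tailProb P N X x)
      atTop (𝓝 (∫ s, φ s ∂(μ h)))

/-- Condition (M) on the time series `X` and the thresholds `r`. -/
def ConditionM (P : Measure Ω) (N : Seminorm ℝ (Fin d → ℝ)) (X : ℤ → Ω → Fin d → ℝ)
    (r : ℕ → ℝ) : Prop :=
  ((fun n : ℕ => (tailProb P N X (r n))⁻¹) =o[atTop] fun n : ℕ => (n : ℝ) ^ (1 / 3 : ℝ)) ∧
  ∃ l : ℕ → ℕ,
    Tendsto l atTop atTop ∧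
    Tendsto (fun n => (l n : ℝ) * tailProb P N X (r n)) atTop (𝓝 0) ∧
    (∃ δ : ℝ, 0 < δ ∧ δ < 1 ∧
      Tendsto
        (fun n => ENNReal.ofReal ((1 / tailProb P N X (r n)) ^ δ) *
          ∑' k : ℕ, ENNReal.ofReal (mixingCoeff P X (l n + k) ^ δ))
        atTop (𝓝 0)) ∧
    Tendsto
      (fun h : ℕ => limsup
        (fun n : ℕ => (ENNReal.ofReal (tailProb P N X (r n)))⁻¹ *
          ∑ j ∈ Finset.Icc h (l n), P {ω | r n < N (X 0 ω) ∧ r n < N (X (j : ℤ) ω)})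
        atTop)
      atTop (𝓝 0) ∧
    Tendsto (fun n : ℕ => (n : ℝ) * tailProb P N X (r n) * mixingCoeff P X (l n)) atTop (𝓝 0)

/-- The random vector with coordinates
`S_n^{(i)} = ∑_{t=1}^n (f_i(X_t / r_n) - E f_i(X_0 / r_n))`, `i = 1, 2`. -/
def centeredSum (P : Measure Ω) (X : ℤ → Ω → Fin d → ℝ) (r : ℕ → ℝ)
    (f : Fin 2 → ExtSpace d → ℝ) (n : ℕ) (ω : Ω) : EuclideanSpace ℝ (Fin 2) :=
  WithLp.toLp 2 fun i =>
    ∑ t ∈ Finset.Icc 1 n,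
      (f i (scaled (r n) (X (t : ℤ) ω)) - ∫ ω', f i (scaled (r n) (X 0 ω')) ∂P)

end Series

section LimitMeasures

variable {d : ℕ}

/-- The limit measure `μ_0` of `X_0`, on `[-∞, ∞]^d \ {0}`. -/
def marginalMeasure (μ : ∀ h : ℕ, Measure (Fin (h + 1) → ExtSpace d)) : Measure (ExtSpace d) :=
  (μ 0).map fun s => s 0

/-- The limit measure `μ_h` of the pair `(X_0, X_h)`, on `([-∞, ∞]^d × [-∞, ∞]^d) \ {0}`.
For `h = 0` it is the image of the limit measure of `X_0` under `x ↦ (x, x)`. -/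
def pairMeasure (μ : ∀ h : ℕ, Measure (Fin (h + 1) → ExtSpace d)) (h : ℕ) :
    Measure (ExtSpace d × ExtSpace d) :=
  ((μ h).map fun s => (s 0, s (Fin.last h))).restrict {0}ᶜ

/-- `σ_h²(f, g)`, the integral against `μ_h` of the symmetrized product
`(x, y) ↦ (f(x) g(y) + g(x) f(y)) / 2`.  It is `∫ f(x) f(y) μ_h(dx, dy)` if `g = f`,
and `∫ f g dμ_0` if `h = 0`. -/
def lagCov (μ : ∀ h : ℕ, Measure (Fin (h + 1) → ExtSpace d)) (f g : ExtSpace d → ℝ) (h : ℕ) :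
    ℝ :=
  ∫ z, (f z.1 * g z.2 + g z.1 * f z.2) / 2 ∂(pairMeasure μ h)

/-- `σ²(f, g) = σ_0²(f, g) + 2 ∑_{h ≥ 1} σ_h²(f, g)`. -/
def limitCov (μ : ∀ h : ℕ, Measure (Fin (h + 1) → ExtSpace d)) (f g : ExtSpace d → ℝ) : ℝ :=
  lagCov μ f g 0 + 2 * ∑' h : ℕ, lagCov μ f g (h + 1)

/-- The covariance matrix `Σ = [σ²(f_i, f_j)]`. -/
def limitCovMatrix (μ : ∀ h : ℕ, Measure (Fin (h + 1) → ExtSpace d))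
    (f : Fin 2 → ExtSpace d → ℝ) : Matrix (Fin 2) (Fin 2) ℝ :=
  Matrix.of fun i j => limitCov μ (f i) (f j)

end LimitMeasures

end MixingTail

end

namespace MixingTail

/-! ### Covariance inequalities under α-mixing -/

section Mixing

variable {Ω : Type*} {m m₁ m₂ m₀ : MeasurableSpace Ω} {P : Measure Ω} [IsProbabilityMeasure P]

/-! The test functions (`IsTest`) are closed under linear combinations. Hence the characteristic
function of the normalized vector at `t` is that of a scalar sum, at frequency one, for the test
function `t 0 * f 0 + t 1 * f 1`. This is the Cramér–Wold device, and it reduces the limit law to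
the scalar statement `IsTest.tendsto_charFun`. Write p for the tail probability, l for the gap in
condition (M), and α_h for the mixing coefficients. Two ingredients carry the scalar statement.

Covariances. The covariance at lag h, divided by p, converges to an integral against the limit
measure of the block: vague convergence extends to bounded functions continuous almost everywhere
(`tendsto_integral_of_null_discontinuity`), and the product of the means is O(p²). To pass to the
limit in sums over h, the large lags must be uniformly negligible (`exists_tail_bound`). Up to lag l
this follows from (ii) and lp → 0. Beyond l, covariance/p is bounded by multiples of both 1 and
α_h/p, hence of (α_h/p)^δ, whose sum tends to 0 by (i). A Tannery argument then gives summability of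
the limits and convergence of the normalized block variances; the limit variance is therefore
nonnegative, which gives positive semidefiniteness.

Bernstein's blocks. The times 1, …, n are cut into at most np blocks of length ⌈1/p⌉, with the last
l terms of each dropped. Since lp → 0, the dropped terms are negligible in L². Mixing across the
gaps replaces the characteristic function of the sum of blocks by a power of that of one block, with
an error of order np α_l, which tends to 0 by (iii). A normalized block is bounded by a multiple of
p⁻¹/√(np), and this tends to 0 because p⁻¹ = o(n^{1/3}). So a second-order Taylor expansion of the
characteristic function of one block is enough (`norm_integral_cexp_sum_sub_le`).

The convergence in probability needs only the second moment, which is O(1/(np)) after division by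
np. -/

lemma integrable_of_abs_le {α : Type*} [MeasurableSpace α] {ν : Measure α} [IsFiniteMeasure ν]
    {U : α → ℝ} (hU : Measurable U) {C : ℝ} (hC : ∀ ω, |U ω| ≤ C) : Integrable U ν :=
  Integrable.of_bound hU.aestronglyMeasurable C (ae_of_all _ hC)

/-- A functional that is bounded by `a` on the indicators of `m`-measurable sets is bounded by `a`
on the `m`-measurable functions with values in `[0, 1]`. -/
lemma integral_mul_le_of_setIntegral_le (hm : m ≤ m₀) {W U : Ω → ℝ}
    (hW : Integrable W P) {a : ℝ} (ha : ∀ A, MeasurableSet[m] A → ∫ ω in A, W ω ∂P ≤ a)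
    (hU : Measurable[m] U) (hU0 : ∀ ω, 0 ≤ U ω) (hU1 : ∀ ω, U ω ≤ 1) :
    ∫ ω, U ω * W ω ∂P ≤ a := by
  have hUm : Measurable U := hU.mono hm le_rfl
  have hUs : StronglyMeasurable[m] U := hU.stronglyMeasurable
  have hUW : Integrable (fun ω => U ω * W ω) P :=
    hW.bdd_mul (c := 1) hUm.aestronglyMeasurable
      (ae_of_all _ fun ω => by rw [Real.norm_eq_abs, abs_of_nonneg (hU0 ω)]; exact hU1 ω)
  have h1 : P[fun ω => U ω * W ω | m] =ᵐ[P] fun ω => U ω * (P[W | m]) ω :=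
    condExp_mul_of_stronglyMeasurable_left hUs hUW hW
  -- Among weights with values in `[0, 1]`, the indicator of the set where the conditional
  -- expectation is nonnegative maximizes the integral.
  set A : Set Ω := {ω | 0 ≤ (P[W | m]) ω} with hA
  have hAm : MeasurableSet[m] A :=
    (stronglyMeasurable_condExp (m := m) (μ := P) (f := W)).measurable measurableSet_Ici
  calc ∫ ω, U ω * W ω ∂P = ∫ ω, (P[fun ω => U ω * W ω | m]) ω ∂P := (integral_condExp hm).symm
    _ = ∫ ω, U ω * (P[W | m]) ω ∂P := integral_congr_ae h1
    _ ≤ ∫ ω, A.indicator (P[W | m]) ω ∂P := by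
      refine integral_mono_ae ?_ ?_ (ae_of_all _ fun ω => ?_)
      · exact (integrable_condExp (m := m) (μ := P) (f := W)).bdd_mul (c := 1)
          hUm.aestronglyMeasurable
          (ae_of_all _ fun ω => by rw [Real.norm_eq_abs, abs_of_nonneg (hU0 ω)]; exact hU1 ω)
      · exact (integrable_condExp (m := m)).indicator (hm _ hAm)
      · by_cases h : ω ∈ A
        · rw [Set.indicator_of_mem h]
          exact mul_le_of_le_one_left h (hU1 ω)
        · rw [Set.indicator_of_notMem h]
          exact mul_nonpos_of_nonneg_of_nonpos (hU0 ω) (not_le.1 h).le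
    _ = ∫ ω in A, (P[W | m]) ω ∂P := integral_indicator (hm _ hAm)
    _ = ∫ ω in A, W ω ∂P := setIntegral_condExp hm hW hAm
    _ ≤ a := ha A hAm

/-- The mixing covariance inequality for functions with values in `[0, 1]`. -/
lemma abs_cov_le_of_unit (h₁ : m₁ ≤ m₀) (h₂ : m₂ ≤ m₀) {a : ℝ}
    (ha : ∀ A B, MeasurableSet[m₁] A → MeasurableSet[m₂] B →
      |P.real (A ∩ B) - P.real A * P.real B| ≤ a)
    {U V : Ω → ℝ} (hU : Measurable[m₁] U) (hV : Measurable[m₂] V)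
    (hU0 : ∀ ω, 0 ≤ U ω) (hU1 : ∀ ω, U ω ≤ 1) (hV0 : ∀ ω, 0 ≤ V ω) (hV1 : ∀ ω, V ω ≤ 1) :
    |∫ ω, U ω * V ω ∂P - (∫ ω, U ω ∂P) * ∫ ω, V ω ∂P| ≤ a := by
  have hUm : Measurable U := hU.mono h₁ le_rfl
  have hVm : Measurable V := hV.mono h₂ le_rfl
  have iU : Integrable U P := integrable_of_abs_le hUm (C := 1)
    fun ω => by rw [abs_of_nonneg (hU0 ω)]; exact hU1 ω
  have iV : Integrable V P := integrable_of_abs_le hVm (C := 1)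
    fun ω => by rw [abs_of_nonneg (hV0 ω)]; exact hV1 ω
  have iUV : Integrable (fun ω => U ω * V ω) P := integrable_of_abs_le (hUm.mul hVm) (C := 1)
    fun ω => by
      rw [abs_of_nonneg (mul_nonneg (hU0 ω) (hV0 ω))]
      exact mul_le_one₀ (hU1 ω) (hV0 ω) (hV1 ω)
  -- The passage from indicators to functions is made in one variable at a time: first `U` against a
  -- fixed `B`, then `V` against the resulting `U`. The sign `s` turns the absolute value into two
  -- one-sided bounds.
  have step : ∀ s : ℝ, (s = 1 ∨ s = -1) → ∀ B, MeasurableSet[m₂] B →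
      s * (∫ ω in B, U ω ∂P - (∫ ω, U ω ∂P) * P.real B) ≤ a := by
    intro s hs B hB
    have hBm := h₂ _ hB
    have iB : Integrable (B.indicator fun _ => (1 : ℝ)) P :=
      (integrable_const _).indicator hBm
    have iW : Integrable (fun ω => s * (B.indicator (fun _ => (1 : ℝ)) ω - P.real B)) P :=
      (iB.sub (integrable_const _)).const_mul s
    have key := integral_mul_le_of_setIntegral_le h₁ iW (a := a) (U := U) ?_ hU hU0 hU1
    · have e : ∀ ω, U ω * (s * (B.indicator (fun _ => (1 : ℝ)) ω - P.real B)) =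
          s * (B.indicator U ω - U ω * P.real B) := by
        intro ω
        by_cases h : ω ∈ B <;> simp [h] <;> ring
      simp_rw [e] at key
      rwa [integral_const_mul, integral_sub (iU.indicator hBm) (iU.mul_const _),
        integral_indicator hBm, integral_mul_const] at key
    · intro A hA
      have hAm := h₁ _ hA
      rw [integral_const_mul, integral_sub iB.integrableOn (integrable_const _),
        integral_indicator hBm, Measure.restrict_restrict hBm]
      simp only [integral_const, smul_eq_mul, mul_one, MeasurableSet.univ, measureReal_restrict_apply, Set.univ_inter]
      have := ha A B hA hB
      rw [Set.inter_comm B A]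
      rcases hs with rfl | rfl
      · rw [one_mul]; exact (le_abs_self _).trans this
      · rw [neg_one_mul]; exact (neg_le_abs _).trans this
  have step2 : ∀ s : ℝ, (s = 1 ∨ s = -1) →
      s * (∫ ω, U ω * V ω ∂P - (∫ ω, U ω ∂P) * ∫ ω, V ω ∂P) ≤ a := by
    intro s hs
    have iW : Integrable (fun ω => s * (U ω - ∫ ω', U ω' ∂P)) P :=
      (iU.sub (integrable_const _)).const_mul s
    have key := integral_mul_le_of_setIntegral_le h₂ iW (a := a) (U := V) ?_ hV hV0 hV1
    · have e : ∀ ω, V ω * (s * (U ω - ∫ ω', U ω' ∂P)) =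
          s * (U ω * V ω - (∫ ω', U ω' ∂P) * V ω) := fun ω => by ring
      simp_rw [e] at key
      rwa [integral_const_mul, integral_sub iUV (iV.const_mul _), integral_const_mul] at key
    · intro B hB
      rw [integral_const_mul, integral_sub iU.integrableOn (integrable_const _)]
      simp only [integral_const, smul_eq_mul, MeasurableSet.univ, measureReal_restrict_apply, Set.univ_inter]
      rw [mul_comm (P.real B)]
      exact step s hs B hB
  rw [abs_le]
  constructor
  · linarith [step2 (-1) (Or.inr rfl)]
  · linarith [step2 1 (Or.inl rfl)]

/-- The mixing covariance inequality for bounded functions. -/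
lemma abs_cov_le (h₁ : m₁ ≤ m₀) (h₂ : m₂ ≤ m₀) {a : ℝ}
    (ha : ∀ A B, MeasurableSet[m₁] A → MeasurableSet[m₂] B →
      |P.real (A ∩ B) - P.real A * P.real B| ≤ a)
    {U V : Ω → ℝ} (hU : Measurable[m₁] U) (hV : Measurable[m₂] V) {C D : ℝ} (hC : 0 < C)
    (hD : 0 < D) (hUC : ∀ ω, |U ω| ≤ C) (hVD : ∀ ω, |V ω| ≤ D) :
    |∫ ω, U ω * V ω ∂P - (∫ ω, U ω ∂P) * ∫ ω, V ω ∂P| ≤ 4 * C * D * a := by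
  have hUm : Measurable U := hU.mono h₁ le_rfl
  have hVm : Measurable V := hV.mono h₂ le_rfl
  have iU : Integrable U P := integrable_of_abs_le hUm hUC
  have iV : Integrable V P := integrable_of_abs_le hVm hVD
  have iUV : Integrable (fun ω => U ω * V ω) P := integrable_of_abs_le (hUm.mul hVm) (C := C * D)
    fun ω => by rw [abs_mul]; exact mul_le_mul (hUC ω) (hVD ω) (abs_nonneg _) hC.le
  -- Affine rescaling to `[0, 1]` divides the covariance by `(2 * C) * (2 * D)`, which is the source
  -- of the factor 4.
  have key := abs_cov_le_of_unit h₁ h₂ ha (U := fun ω => (U ω + C) / (2 * C))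
    (V := fun ω => (V ω + D) / (2 * D)) ((hU.add_const _).div_const _)
    ((hV.add_const _).div_const _)
    (fun ω => div_nonneg (by linarith [(abs_le.1 (hUC ω)).1]) (by positivity))
    (fun ω => (div_le_one (by positivity)).2 (by linarith [(abs_le.1 (hUC ω)).2]))
    (fun ω => div_nonneg (by linarith [(abs_le.1 (hVD ω)).1]) (by positivity))
    (fun ω => (div_le_one (by positivity)).2 (by linarith [(abs_le.1 (hVD ω)).2]))
  have e : ∀ ω, (U ω + C) / (2 * C) * ((V ω + D) / (2 * D)) =
      (U ω * V ω + D * U ω + C * V ω + C * D) / (4 * C * D) := fun ω => by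
    field_simp; ring
  simp_rw [e] at key
  rw [integral_div, integral_div, integral_div, integral_add (by fun_prop) (by fun_prop), integral_add (by fun_prop) (by fun_prop),
    integral_add (by fun_prop) (by fun_prop), integral_add (by fun_prop) (by fun_prop), integral_add (by fun_prop) (by fun_prop)] at key
  simp only [integral_const_mul, integral_const, smul_eq_mul, probReal_univ, one_mul] at key
  have e2 : (∫ ω, U ω * V ω ∂P + D * ∫ ω, U ω ∂P + C * ∫ ω, V ω ∂P + C * D) / (4 * C * D) -
      (∫ ω, U ω ∂P + C) / (2 * C) * ((∫ ω, V ω ∂P + D) / (2 * D)) =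
      (∫ ω, U ω * V ω ∂P - (∫ ω, U ω ∂P) * ∫ ω, V ω ∂P) / (4 * C * D) := by
    field_simp; ring
  rw [e2, abs_div, abs_of_pos (by positivity : 0 < 4 * C * D), div_le_iff₀ (by positivity)] at key
  linarith

/-- The mixing covariance inequality for complex functions bounded by `1`. -/
lemma norm_cov_le (h₁ : m₁ ≤ m₀) (h₂ : m₂ ≤ m₀) {a : ℝ}
    (ha : ∀ A B, MeasurableSet[m₁] A → MeasurableSet[m₂] B →
      |P.real (A ∩ B) - P.real A * P.real B| ≤ a)
    {U V : Ω → ℂ} (hU : Measurable[m₁] U) (hV : Measurable[m₂] V)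
    (hU1 : ∀ ω, ‖U ω‖ ≤ 1) (hV1 : ∀ ω, ‖V ω‖ ≤ 1) :
    ‖∫ ω, U ω * V ω ∂P - (∫ ω, U ω ∂P) * ∫ ω, V ω ∂P‖ ≤ 16 * a := by
  have hUm : Measurable U := hU.mono h₁ le_rfl
  have hVm : Measurable V := hV.mono h₂ le_rfl
  have iU : Integrable U P := Integrable.of_bound hUm.aestronglyMeasurable 1 (ae_of_all _ hU1)
  have iV : Integrable V P := Integrable.of_bound hVm.aestronglyMeasurable 1 (ae_of_all _ hV1)
  have iUV : Integrable (fun ω => U ω * V ω) P :=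
    Integrable.of_bound (hUm.mul hVm).aestronglyMeasurable 1 (ae_of_all _ fun ω => by
      rw [norm_mul]; exact mul_le_one₀ (hU1 ω) (norm_nonneg _) (hV1 ω))
  have bUr : ∀ ω, |(U ω).re| ≤ 1 := fun ω => (Complex.abs_re_le_norm _).trans (hU1 ω)
  have bUi : ∀ ω, |(U ω).im| ≤ 1 := fun ω => (Complex.abs_im_le_norm _).trans (hU1 ω)
  have bVr : ∀ ω, |(V ω).re| ≤ 1 := fun ω => (Complex.abs_re_le_norm _).trans (hV1 ω)
  have bVi : ∀ ω, |(V ω).im| ≤ 1 := fun ω => (Complex.abs_im_le_norm _).trans (hV1 ω)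
  have mUr : Measurable[m₁] fun ω => (U ω).re := Complex.measurable_re.comp hU
  have mUi : Measurable[m₁] fun ω => (U ω).im := Complex.measurable_im.comp hU
  have mVr : Measurable[m₂] fun ω => (V ω).re := Complex.measurable_re.comp hV
  have mVi : Measurable[m₂] fun ω => (V ω).im := Complex.measurable_im.comp hV
  have ib : ∀ f g : Ω → ℝ, Measurable f → Measurable g → (∀ ω, |f ω| ≤ 1) → (∀ ω, |g ω| ≤ 1) →
      Integrable (fun ω => f ω * g ω) P := fun f g hf hg bf bg =>
    integrable_of_abs_le (hf.mul hg) (C := 1) fun ω => by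
      rw [abs_mul]; exact mul_le_one₀ (bf ω) (abs_nonneg _) (bg ω)
  have k1 := abs_cov_le h₁ h₂ ha mUr mVr one_pos one_pos bUr bVr
  have k2 := abs_cov_le h₁ h₂ ha mUi mVi one_pos one_pos bUi bVi
  have k3 := abs_cov_le h₁ h₂ ha mUr mVi one_pos one_pos bUr bVi
  have k4 := abs_cov_le h₁ h₂ ha mUi mVr one_pos one_pos bUi bVr
  have mUr' := mUr.mono h₁ le_rfl
  have mUi' := mUi.mono h₁ le_rfl
  have mVr' := mVr.mono h₂ le_rfl
  have mVi' := mVi.mono h₂ le_rfl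
  have re_int : ∀ {f : Ω → ℂ}, Integrable f P → (∫ ω, f ω ∂P).re = ∫ ω, (f ω).re ∂P :=
    fun hf => (integral_re hf).symm
  have im_int : ∀ {f : Ω → ℂ}, Integrable f P → (∫ ω, f ω ∂P).im = ∫ ω, (f ω).im ∂P :=
    fun hf => (integral_im hf).symm
  refine (Complex.norm_le_abs_re_add_abs_im _).trans ?_
  rw [Complex.sub_re, Complex.sub_im, Complex.mul_re, Complex.mul_im, re_int iUV, im_int iUV,
    re_int iU, re_int iV, im_int iU, im_int iV]
  simp only [Complex.mul_re, Complex.mul_im]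
  rw [integral_sub (ib _ _ mUr' mVr' bUr bVr) (ib _ _ mUi' mVi' bUi bVi),
    integral_add (ib _ _ mUr' mVi' bUr bVi) (ib _ _ mUi' mVr' bUi bVr)]
  rw [abs_le] at k1 k2 k3 k4
  -- The real and imaginary parts of the complex covariance are each a combination of two real
  -- covariances, and each of these is at most `4 * a`.
  have hre : ∀ x y : ℝ, |x| ≤ 8 * a → |y| ≤ 8 * a → |x| + |y| ≤ 16 * a := by
    intro x y hx hy; linarith
  apply hre <;> rw [abs_le] <;> constructor <;> linarith

end Mixing

/-! ### Past and future σ-algebras of a stationary series -/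

section SigmaAlg

variable {Ω : Type*} {d : ℕ} {X : ℤ → Ω → Fin d → ℝ}

/-- The `σ`-algebra generated by `X s` for `s ∈ S`. -/
abbrev sigmaAlg (X : ℤ → Ω → Fin d → ℝ) (S : Set ℤ) : MeasurableSpace Ω :=
  ⨆ s : S, MeasurableSpace.comap (X s) inferInstance

lemma measurable_sigmaAlg {S : Set ℤ} {s : ℤ} (hs : s ∈ S) : Measurable[sigmaAlg X S] (X s) :=
  Measurable.mono (comap_measurable (X s))
    (le_iSup (fun s : S => MeasurableSpace.comap (X s) inferInstance) ⟨s, hs⟩) le_rfl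

/-- Stationarity is a statement about the law of the path, so events have to be realized as
preimages of sets of paths before they can be shifted. -/
lemma sigmaAlg_eq_comap (S : Set ℤ) :
    sigmaAlg X S = MeasurableSpace.comap (fun ω t => X t ω)
      (⨆ s : S, MeasurableSpace.comap (fun x : ℤ → Fin d → ℝ => x s) inferInstance) := by
  rw [MeasurableSpace.comap_iSup]
  simp only [MeasurableSpace.comap_comp]
  rfl

end SigmaAlg

section Stationary

variable {Ω : Type*} [MeasurableSpace Ω] {P : Measure Ω} {d : ℕ} {X : ℤ → Ω → Fin d → ℝ}

lemma IsStationary.identDistrib (hstat : IsStationary P X) (hX : ∀ t, Measurable (X t)) (k : ℤ) :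
    IdentDistrib (fun ω t => X (t + k) ω) (fun ω t => X t ω) P P :=
  ⟨(measurable_pi_lambda _ fun t => hX (t + k)).aemeasurable,
    (measurable_pi_lambda _ hX).aemeasurable, hstat k⟩

lemma IsStationary.identDistrib_comp (hstat : IsStationary P X) (hX : ∀ t, Measurable (X t))
    {β : Type*} [MeasurableSpace β] {Φ : (ℤ → Fin d → ℝ) → β} (hΦ : Measurable Φ) (k : ℤ) :
    IdentDistrib (fun ω => Φ fun t => X (t + k) ω) (fun ω => Φ fun t => X t ω) P P :=
  (hstat.identDistrib hX k).comp hΦ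

lemma IsStationary.integral_comp (hstat : IsStationary P X) (hX : ∀ t, Measurable (X t))
    {E : Type*} [NormedAddCommGroup E] [NormedSpace ℝ E] [MeasurableSpace E] [BorelSpace E]
    [SecondCountableTopology E]
    {Φ : (ℤ → Fin d → ℝ) → E} (hΦ : Measurable Φ) (k : ℤ) :
    ∫ ω, Φ (fun t => X (t + k) ω) ∂P = ∫ ω, Φ (fun t => X t ω) ∂P :=
  (hstat.identDistrib_comp hX hΦ k).integral_eq

lemma sigmaAlg_le (hX : ∀ t, Measurable (X t)) (S : Set ℤ) :
    sigmaAlg X S ≤ (inferInstance : MeasurableSpace Ω) :=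
  iSup_le fun s => (hX s).comap_le

lemma coord_iSup_le (S : Set ℤ) :
    (⨆ s : S, MeasurableSpace.comap (fun x : ℤ → Fin d → ℝ => x s) inferInstance) ≤
      (inferInstance : MeasurableSpace (ℤ → Fin d → ℝ)) :=
  iSup_le fun s => (measurable_pi_apply (s : ℤ)).comap_le

variable [IsProbabilityMeasure P]

lemma bddAbove_mixing (P : Measure Ω) [IsProbabilityMeasure P] (X : ℤ → Ω → Fin d → ℝ) (h : ℕ) :
    BddAbove {a : ℝ | ∃ A B : Set Ω,
      MeasurableSet[⨆ s : {s : ℤ // s ≤ 0}, MeasurableSpace.comap (X s) inferInstance] A ∧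
      MeasurableSet[⨆ s : {s : ℤ // (h : ℤ) ≤ s}, MeasurableSpace.comap (X s) inferInstance] B ∧
      a = |P.real (A ∩ B) - P.real A * P.real B|} := by
  refine ⟨1, ?_⟩
  rintro a ⟨A, B, -, -, rfl⟩
  have h1 : P.real (A ∩ B) ≤ 1 := measureReal_le_one
  have h2 : P.real A ≤ 1 := measureReal_le_one
  have h3 : P.real B ≤ 1 := measureReal_le_one
  have h4 : (0 : ℝ) ≤ P.real (A ∩ B) := measureReal_nonneg
  have h5 : (0 : ℝ) ≤ P.real A := measureReal_nonneg
  have h6 : (0 : ℝ) ≤ P.real B := measureReal_nonneg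
  rw [abs_le]
  constructor <;> nlinarith [mul_nonneg h5 h6, mul_le_one₀ h2 h6 h3]

lemma mixingCoeff_nonneg (P : Measure Ω) (X : ℤ → Ω → Fin d → ℝ) (h : ℕ) :
    0 ≤ mixingCoeff P X h := by
  apply Real.sSup_nonneg
  rintro a ⟨A, B, -, -, rfl⟩
  exact abs_nonneg _

/-- Mixing between the past up to time `k` and the future from time `k + h`. -/
lemma IsStationary.abs_sub_le_mixingCoeff (hstat : IsStationary P X)
    (hX : ∀ t, Measurable (X t)) (k : ℤ) (h : ℕ) {A B : Set Ω}
    (hA : MeasurableSet[sigmaAlg X {s | s ≤ k}] A)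
    (hB : MeasurableSet[sigmaAlg X {s | k + h ≤ s}] B) :
    |P.real (A ∩ B) - P.real A * P.real B| ≤ mixingCoeff P X h := by
  rw [sigmaAlg_eq_comap] at hA hB
  obtain ⟨A', hA', rfl⟩ := hA
  obtain ⟨B', hB', rfl⟩ := hB
  have mA := coord_iSup_le _ _ hA'
  have mB := coord_iSup_le _ _ hB'
  -- Shifting the paths by `-k` preserves all three probabilities and moves the past up to `k` to
  -- the past up to `0`, where the definition of the mixing coefficient applies.
  have shift : ∀ T : Set (ℤ → Fin d → ℝ), MeasurableSet T →
      P.real ((fun ω t => X t ω) ⁻¹' T) = P.real ((fun ω t => X (t + -k) ω) ⁻¹' T) := by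
    intro T hT
    rw [measureReal_def, measureReal_def, (hstat.identDistrib hX (-k)).measure_mem_eq hT]
  have hsub : ∀ S : Set ℤ, ∀ S' : Set ℤ, (∀ s ∈ S, s + -k ∈ S') → ∀ T : Set (ℤ → Fin d → ℝ),
      MeasurableSet[⨆ s : S, MeasurableSpace.comap (fun x : ℤ → Fin d → ℝ => x s) inferInstance] T →
      MeasurableSet[sigmaAlg X S'] ((fun ω t => X (t + -k) ω) ⁻¹' T) := by
    intro S S' hS T hT
    have : MeasurableSpace.comap (fun ω t => X (t + -k) ω)
        (⨆ s : S, MeasurableSpace.comap (fun x : ℤ → Fin d → ℝ => x s) inferInstance) ≤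
        sigmaAlg X S' := by
      rw [MeasurableSpace.comap_iSup]
      refine iSup_le fun s => ?_
      rw [MeasurableSpace.comap_comp]
      exact le_iSup (fun s : S' => MeasurableSpace.comap (X s) inferInstance)
        ⟨(s : ℤ) + -k, hS s s.2⟩
    exact this _ ⟨T, hT, rfl⟩
  rw [← Set.preimage_inter, shift _ (mA.inter mB), shift _ mA, shift _ mB, Set.preimage_inter]
  refine le_csSup (bddAbove_mixing P X h) ⟨_, _, ?_, ?_, rfl⟩
  · exact hsub {s | s ≤ k} {s | s ≤ 0} (fun s hs => by simp at hs ⊢; omega) A' hA'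
  · exact hsub {s | k + h ≤ s} {s | (h : ℤ) ≤ s} (fun s hs => by simp at hs ⊢; omega) B' hB'

end Stationary

end MixingTail
namespace MixingTail

/-! ### Bernstein's blocks and characteristic functions -/

section Blocks

lemma norm_exp_sub_exp_le (x y : ℝ) :
    ‖Complex.exp (Complex.I * x) - Complex.exp (Complex.I * y)‖ ≤ |x - y| := by
  have e : Complex.exp (Complex.I * x) - Complex.exp (Complex.I * y) =
      Complex.exp (Complex.I * y) * (Complex.exp (Complex.I * ((x - y : ℝ) : ℂ)) - 1) := by
    rw [mul_sub, ← Complex.exp_add, mul_one]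
    congr 2
    push_cast; ring
  rw [e, norm_mul, Complex.norm_exp_I_mul_ofReal, one_mul]
  exact Real.norm_exp_I_mul_ofReal_sub_one_le

lemma norm_exp_sub_quadratic_le {x : ℝ} (hx : |x| ≤ 1) :
    ‖Complex.exp (Complex.I * x) - (1 + Complex.I * x - (x : ℂ) ^ 2 / 2)‖ ≤ |x| ^ 3 := by
  have hn : ‖Complex.I * (x : ℂ)‖ = |x| := by simp
  have h := Complex.exp_bound (x := Complex.I * x) (by rw [hn]; exact hx) (n := 3) (by norm_num)
  rw [hn] at h
  have e : ∑ m ∈ Finset.range 3, (Complex.I * (x : ℂ)) ^ m / (m.factorial : ℂ) =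
      1 + Complex.I * x - (x : ℂ) ^ 2 / 2 := by
    simp [Finset.sum_range_succ, Nat.factorial, mul_pow, Complex.I_sq]
    ring
  rw [e] at h
  refine h.trans ?_
  have : (0 : ℝ) ≤ |x| ^ 3 := by positivity
  norm_num [Nat.factorial]
  linarith

variable {Ω : Type*} [MeasurableSpace Ω] {P : Measure Ω} [IsProbabilityMeasure P]

lemma integral_abs_le_sqrt {Z : Ω → ℝ} (hZ : Measurable Z) {C : ℝ} (hC : ∀ ω, |Z ω| ≤ C) :
    ∫ ω, |Z ω| ∂P ≤ √(∫ ω, Z ω ^ 2 ∂P) := by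
  have i1 : Integrable (fun ω => |Z ω|) P := (integrable_of_abs_le hZ hC).abs
  have i2 : Integrable (fun ω => Z ω ^ 2) P := integrable_of_abs_le (hZ.pow_const 2) (C := C ^ 2)
    fun ω => by
      rw [abs_pow]; exact pow_le_pow_left₀ (abs_nonneg _) (hC ω) 2
  set c := ∫ ω, |Z ω| ∂P with hc
  -- The claim is that the variance of `|Z|` is nonnegative.
  have h : 0 ≤ ∫ ω, (|Z ω| - c) ^ 2 ∂P := integral_nonneg fun ω => sq_nonneg _
  have e : ∀ ω, (|Z ω| - c) ^ 2 = Z ω ^ 2 - 2 * c * |Z ω| + c ^ 2 := fun ω => by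
    rw [← sq_abs (Z ω)]; ring
  simp_rw [e] at h
  rw [integral_add (by fun_prop) (by fun_prop), integral_sub (by fun_prop) (by fun_prop), integral_const_mul, integral_const, probReal_univ,
    one_smul, ← hc] at h
  apply Real.le_sqrt_of_sq_le
  nlinarith

lemma integrable_cexp {Z : Ω → ℝ} (hZ : Measurable Z) :
    Integrable (fun ω => Complex.exp (Complex.I * Z ω)) P :=
  Integrable.of_bound (by fun_prop) 1
    (ae_of_all _ fun ω => (Complex.norm_exp_I_mul_ofReal _).le)

lemma norm_integral_cexp_le (Z : Ω → ℝ) :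
    ‖∫ ω, Complex.exp (Complex.I * Z ω) ∂P‖ ≤ 1 := by
  refine (norm_integral_le_integral_norm _).trans ?_
  simp_rw [Complex.norm_exp_I_mul_ofReal]
  simp

lemma norm_integral_cexp_sub_le {S T : Ω → ℝ} (hS : Measurable S) (hT : Measurable T) {C : ℝ}
    (hC : ∀ ω, |S ω - T ω| ≤ C) :
    ‖∫ ω, Complex.exp (Complex.I * S ω) ∂P - ∫ ω, Complex.exp (Complex.I * T ω) ∂P‖ ≤
      √(∫ ω, (S ω - T ω) ^ 2 ∂P) := by
  rw [← integral_sub (integrable_cexp hS) (integrable_cexp hT)]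
  refine (norm_integral_le_integral_norm _).trans ?_
  refine le_trans ?_ (integral_abs_le_sqrt (hS.sub hT) hC)
  exact integral_mono ((integrable_cexp hS).sub (integrable_cexp hT)).norm
    (integrable_of_abs_le (hS.sub hT) hC).abs fun ω => norm_exp_sub_exp_le _ _

/-- The linear term integrates to zero because `Z` is centered, and the cubic remainder satisfies
`|Z| ^ 3 ≤ c * Z ^ 2`. The error is thus a small multiple of the variance, and no third moment is
needed. -/
lemma norm_integral_cexp_sub_quadratic_le {Z : Ω → ℝ} (hZ : Measurable Z) {c : ℝ}
    (hc : ∀ ω, |Z ω| ≤ c) (hc1 : c ≤ 1) (h0 : ∫ ω, Z ω ∂P = 0) :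
    ‖∫ ω, Complex.exp (Complex.I * Z ω) ∂P - ((1 - (∫ ω, Z ω ^ 2 ∂P) / 2 : ℝ) : ℂ)‖ ≤
      c * ∫ ω, Z ω ^ 2 ∂P := by
  have i1 : Integrable Z P := integrable_of_abs_le hZ hc
  have i2 : Integrable (fun ω => Z ω ^ 2) P := integrable_of_abs_le (hZ.pow_const 2) (C := c ^ 2)
    fun ω => by
      rw [abs_pow]; exact pow_le_pow_left₀ (abs_nonneg _) (hc ω) 2
  have iq : Integrable (fun ω => (1 + Complex.I * (Z ω : ℂ) - (Z ω : ℂ) ^ 2 / 2)) P := by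
    have j1 : Integrable (fun ω => (Z ω : ℂ)) P := i1.ofReal
    have j2 : Integrable (fun ω => (Z ω : ℂ) ^ 2) P := by
      simpa using i2.ofReal (𝕜 := ℂ)
    exact ((integrable_const _).add (j1.const_mul _)).sub (j2.div_const _)
  have e : ∫ ω, (1 + Complex.I * (Z ω : ℂ) - (Z ω : ℂ) ^ 2 / 2) ∂P =
      ((1 - (∫ ω, Z ω ^ 2 ∂P) / 2 : ℝ) : ℂ) := by
    have j1 : Integrable (fun ω => (Z ω : ℂ)) P := i1.ofReal
    have j2 : Integrable (fun ω => (Z ω : ℂ) ^ 2) P := by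
      simpa using i2.ofReal (𝕜 := ℂ)
    rw [integral_sub (by fun_prop) (by fun_prop), integral_add (by fun_prop) (by fun_prop), integral_const_mul, integral_div,
      integral_complex_ofReal, h0]
    have : ∫ ω, (Z ω : ℂ) ^ 2 ∂P = ((∫ ω, Z ω ^ 2 ∂P : ℝ) : ℂ) := by
      rw [← integral_complex_ofReal]; simp
    rw [this]
    simp
  rw [← e, ← integral_sub (integrable_cexp hZ) iq]
  refine (norm_integral_le_integral_norm _).trans ?_
  rw [← integral_const_mul]
  refine integral_mono ((integrable_cexp hZ).sub iq).norm (i2.const_mul _) fun ω => ?_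
  refine (norm_exp_sub_quadratic_le ((hc ω).trans hc1)).trans ?_
  have : |Z ω| ^ 3 = |Z ω| * Z ω ^ 2 := by rw [← sq_abs]; ring
  rw [this]
  exact mul_le_mul_of_nonneg_right (hc ω) (sq_nonneg _)

lemma norm_pow_sub_pow_le {z w : ℂ} (hz : ‖z‖ ≤ 1) (hw : ‖w‖ ≤ 1) (k : ℕ) :
    ‖z ^ k - w ^ k‖ ≤ k * ‖z - w‖ := by
  induction k with
  | zero => simp
  | succ k ih =>
    have e : z ^ (k + 1) - w ^ (k + 1) = z * (z ^ k - w ^ k) + (z - w) * w ^ k := by ring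
    rw [e]
    refine (norm_add_le _ _).trans ?_
    rw [norm_mul, norm_mul, norm_pow]
    have h1 : ‖z‖ * ‖z ^ k - w ^ k‖ ≤ k * ‖z - w‖ :=
      (mul_le_of_le_one_left (norm_nonneg _) hz).trans ih
    have h2 : ‖z - w‖ * ‖w‖ ^ k ≤ ‖z - w‖ :=
      mul_le_of_le_one_right (norm_nonneg _) (pow_le_one₀ (norm_nonneg _) hw)
    push_cast
    linarith

variable {d : ℕ} {X : ℤ → Ω → Fin d → ℝ} {g : (Fin d → ℝ) → ℝ}

/-- The sum over the big blocks `[j m + 1, j m + 1 + L)`, `j < k`. -/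
def blockSum (X : ℤ → Ω → Fin d → ℝ) (g : (Fin d → ℝ) → ℝ) (m L k : ℕ) (ω : Ω) : ℝ :=
  ∑ j ∈ Finset.range k, ∑ t ∈ Finset.range L, g (X ((j * m + 1 + t : ℕ) : ℤ) ω)

/-- The characteristic function of the sum of the big blocks is nearly a power. -/
lemma norm_integral_blockSum_sub_pow_le (hstat : IsStationary P X) (hX : ∀ t, Measurable (X t))
    (hg : Measurable g) {m L l : ℕ} (hm : L + l ≤ m) (k : ℕ) :
    ‖∫ ω, Complex.exp (Complex.I * blockSum X g m L k ω) ∂P -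
      (∫ ω, Complex.exp (Complex.I * (∑ t ∈ Finset.range L, g (X (t : ℤ) ω) : ℝ)) ∂P) ^ k‖ ≤
      16 * k * mixingCoeff P X l := by
  set φ := ∫ ω, Complex.exp (Complex.I * (∑ t ∈ Finset.range L, g (X (t : ℤ) ω) : ℝ)) ∂P with hφ
  induction k with
  | zero => simp [blockSum]
  | succ k ih =>
    set T := blockSum X g m L k with hT
    set B : Ω → ℝ := fun ω => ∑ t ∈ Finset.range L, g (X ((k * m + 1 + t : ℕ) : ℤ) ω) with hB
    have hsucc : ∀ ω, blockSum X g m L (k + 1) ω = T ω + B ω := fun ω => by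
      simp [blockSum, hT, hB, Finset.sum_range_succ]
    have hΦ : Measurable fun x : ℤ → Fin d → ℝ =>
        Complex.exp (Complex.I * (∑ t ∈ Finset.range L, g (x (t : ℤ)) : ℝ)) := by
      have : Measurable fun x : ℤ → Fin d → ℝ => ∑ t ∈ Finset.range L, g (x (t : ℤ)) :=
        Finset.measurable_fun_sum _ fun t _ => hg.comp (measurable_pi_apply _)
      fun_prop
    have hBφ : ∫ ω, Complex.exp (Complex.I * B ω) ∂P = φ := by
      have := hstat.integral_comp hX
        (Φ := fun x => Complex.exp (Complex.I * (∑ t ∈ Finset.range L, g (x (t : ℤ)) : ℝ)))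
        hΦ ((k * m + 1 : ℕ) : ℤ)
      rw [hφ, ← this]
      refine integral_congr_ae (ae_of_all _ fun ω => ?_)
      have e : ∀ t : ℕ, ((k * m + 1 + t : ℕ) : ℤ) = (t : ℤ) + ((k * m + 1 : ℕ) : ℤ) := fun t => by
        push_cast; ring
      simp only [hB, e]
    -- The last index in the first `k` blocks is at most `(k - 1) * m + L ≤ k * m - l`, whereas the
    -- next block starts at `k * m + 1`. The gap is therefore at least `l`.
    have hTm : Measurable[sigmaAlg X {s | s ≤ (k * m : ℤ) - l}] T := by
      refine Finset.measurable_fun_sum _ fun j hj => Finset.measurable_fun_sum _ fun t ht => ?_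
      refine hg.comp (measurable_sigmaAlg ?_)
      rw [Finset.mem_range] at hj ht
      have : (j + 1) * m ≤ k * m := Nat.mul_le_mul_right _ hj
      have h3 : j * m + 1 + t + l ≤ k * m := by nlinarith
      simp only [Set.mem_ofPred_eq]
      have : ((j * m + 1 + t + l : ℕ) : ℤ) ≤ ((k * m : ℕ) : ℤ) := by exact_mod_cast h3
      push_cast at this ⊢
      linarith
    have hBm : Measurable[sigmaAlg X {s | (k * m : ℤ) - l + l ≤ s}] B := by
      refine Finset.measurable_fun_sum _ fun t ht => ?_
      refine hg.comp (measurable_sigmaAlg ?_)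
      simp only [Set.mem_ofPred_eq]
      push_cast
      linarith [Int.natCast_nonneg t]
    have mix := norm_cov_le (P := P) (sigmaAlg_le hX _) (sigmaAlg_le hX _)
      (fun A B' hA hB' => hstat.abs_sub_le_mixingCoeff hX ((k * m : ℤ) - l) l hA hB')
      (U := fun ω => Complex.exp (Complex.I * T ω)) (V := fun ω => Complex.exp (Complex.I * B ω))
      (Complex.measurable_exp.comp ((Complex.measurable_ofReal.comp hTm).const_mul _))
      (Complex.measurable_exp.comp ((Complex.measurable_ofReal.comp hBm).const_mul _))
      (fun ω => (Complex.norm_exp_I_mul_ofReal _).le)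
      (fun ω => (Complex.norm_exp_I_mul_ofReal _).le)
    rw [hBφ] at mix
    have e : ∀ ω, Complex.exp (Complex.I * blockSum X g m L (k + 1) ω) =
        Complex.exp (Complex.I * T ω) * Complex.exp (Complex.I * B ω) := fun ω => by
      rw [hsucc, ← Complex.exp_add]
      push_cast; ring_nf
    simp_rw [e]
    have hφ1 : ‖φ‖ ≤ 1 := by rw [← hBφ]; exact norm_integral_cexp_le B
    -- Splitting off the last block costs one mixing error; the error accumulated so far is
    -- multiplied by `φ`, which has modulus at most one.
    have e2 : ∫ ω, Complex.exp (Complex.I * T ω) * Complex.exp (Complex.I * B ω) ∂P - φ ^ (k + 1) =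
        (∫ ω, Complex.exp (Complex.I * T ω) * Complex.exp (Complex.I * B ω) ∂P -
          (∫ ω, Complex.exp (Complex.I * T ω) ∂P) * φ) +
        (∫ ω, Complex.exp (Complex.I * T ω) ∂P - φ ^ k) * φ := by ring
    rw [e2]
    refine (norm_add_le _ _).trans ?_
    rw [norm_mul (_ - _) φ]
    have := (mul_le_of_le_one_right (norm_nonneg _) hφ1).trans ih
    push_cast
    linarith

/-- A quantitative central limit theorem for a sum of bounded, centered functions of a stationary
mixing sequence, by Bernstein's blocks. -/
lemma norm_integral_cexp_sum_sub_le (hstat : IsStationary P X) (hX : ∀ t, Measurable (X t))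
    (hg : Measurable g) {b : ℝ} (hb : ∀ x, |g x| ≤ b) (h0 : ∫ ω, g (X 0 ω) ∂P = 0)
    {m L l n k : ℕ} (hm : L + l ≤ m) (hbL : L * b ≤ 1) :
    ‖∫ ω, Complex.exp (Complex.I * (∑ t ∈ Finset.Icc 1 n, g (X (t : ℤ) ω) : ℝ)) ∂P -
      (Real.exp (-(k * ∫ ω, (∑ t ∈ Finset.range L, g (X (t : ℤ) ω)) ^ 2 ∂P) / 2) : ℂ)‖ ≤
      √(∫ ω, (∑ t ∈ Finset.Icc 1 n, g (X (t : ℤ) ω) - blockSum X g m L k ω) ^ 2 ∂P) +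
      16 * k * mixingCoeff P X l +
      k * (L * b * ∫ ω, (∑ t ∈ Finset.range L, g (X (t : ℤ) ω)) ^ 2 ∂P +
        (∫ ω, (∑ t ∈ Finset.range L, g (X (t : ℤ) ω)) ^ 2 ∂P) ^ 2) := by
  set B : Ω → ℝ := fun ω => ∑ t ∈ Finset.range L, g (X (t : ℤ) ω) with hB
  set v := ∫ ω, B ω ^ 2 ∂P with hv
  have hgX : ∀ t, Measurable fun ω => g (X t ω) := fun t => hg.comp (hX t)
  have hBm : Measurable B := Finset.measurable_fun_sum _ fun t _ => hgX t
  have hBb : ∀ ω, |B ω| ≤ L * b := fun ω => by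
    refine (Finset.abs_sum_le_sum_abs _ _).trans ?_
    refine (Finset.sum_le_sum fun t _ => hb _).trans ?_
    simp
  have hB0 : ∫ ω, B ω ∂P = 0 := by
    simp only [hB]
    rw [integral_finsetSum _ fun (t : ℕ) _ => integrable_of_abs_le (hgX t) fun ω => hb _]
    refine Finset.sum_eq_zero fun t _ => ?_
    rw [← h0]
    simpa using hstat.integral_comp hX (Φ := fun x => g (x 0)) (by fun_prop) (t : ℤ)
  have hv0 : 0 ≤ v := integral_nonneg fun ω => sq_nonneg _
  have hv1 : v ≤ 1 := by
    calc v ≤ ∫ _, (1 : ℝ) ∂P := by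
          refine integral_mono_of_nonneg (ae_of_all _ fun ω => sq_nonneg _) (integrable_const _)
            (ae_of_all _ fun ω => ?_)
          have := (hBb ω).trans hbL
          simp only
          rw [← sq_abs]
          exact pow_le_one₀ (abs_nonneg _) this
      _ = 1 := by simp
  set φ := ∫ ω, Complex.exp (Complex.I * B ω) ∂P with hφ
  have q := norm_integral_cexp_sub_quadratic_le hBm hBb hbL hB0
  -- The second-order expansion of one block is compared with the characteristic function of a
  -- centered Gaussian of the same variance `v`.
  have q2 : ‖((1 - v / 2 : ℝ) : ℂ) - (Real.exp (-v / 2) : ℂ)‖ ≤ v ^ 2 := by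
    rw [← Complex.ofReal_sub, Complex.norm_real, Real.norm_eq_abs, abs_sub_comm]
    have := Real.abs_exp_sub_one_sub_id_le (x := -v / 2) (by rw [abs_le]; constructor <;> linarith)
    have e : Real.exp (-v / 2) - (1 - v / 2) = Real.exp (-v / 2) - 1 - -v / 2 := by ring
    rw [e]
    nlinarith
  have q3 : ‖φ ^ k - (Real.exp (-v / 2) : ℂ) ^ k‖ ≤ k * (L * b * v + v ^ 2) := by
    refine (norm_pow_sub_pow_le (norm_integral_cexp_le B) ?_ k).trans ?_
    · rw [Complex.norm_real, Real.norm_eq_abs, abs_of_pos (Real.exp_pos _)]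
      exact Real.exp_le_one_iff.2 (by linarith)
    · refine mul_le_mul_of_nonneg_left ?_ (Nat.cast_nonneg _)
      exact (norm_sub_le_norm_sub_add_norm_sub _ _ _).trans (add_le_add q q2)
  have e : (Real.exp (-v / 2) : ℂ) ^ k = (Real.exp (-(k * v) / 2) : ℂ) := by
    rw [← Complex.ofReal_pow, ← Real.exp_nat_mul]
    congr 2; ring
  rw [e] at q3
  have hSm : Measurable fun ω => ∑ t ∈ Finset.Icc 1 n, g (X (t : ℤ) ω) :=
    Finset.measurable_fun_sum _ fun t _ => hgX t
  have hTm : Measurable (blockSum X g m L k) :=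
    Finset.measurable_fun_sum _ fun j _ => Finset.measurable_fun_sum _ fun t _ => hgX _
  have q4 := norm_integral_cexp_sub_le (P := P) hSm hTm (C := n * b + k * (L * b)) fun ω => by
    refine (abs_sub _ _).trans (add_le_add ?_ ?_)
    · refine (Finset.abs_sum_le_sum_abs _ _).trans ?_
      refine (Finset.sum_le_sum fun t _ => hb _).trans ?_
      simp
    · refine (Finset.abs_sum_le_sum_abs _ _).trans ?_
      refine (Finset.sum_le_sum (g := fun _ => L * b) fun t _ => ?_).trans (by simp)
      refine (Finset.abs_sum_le_sum_abs _ _).trans ?_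
      refine (Finset.sum_le_sum fun t _ => hb _).trans ?_
      simp
  have q5 := norm_integral_blockSum_sub_pow_le hstat hX hg hm k
  -- The three errors are: discarding the terms outside the big blocks, decoupling the blocks, and
  -- replacing one block by a Gaussian, `k` times.
  refine (norm_sub_le_norm_sub_add_norm_sub _ (φ ^ k) _).trans ?_
  refine add_le_add ((norm_sub_le_norm_sub_add_norm_sub _ _ _).trans (add_le_add q4 q5)) q3

end Blocks

/-! ### Second moments of sums over a stationary series -/

section Covariance

variable {Ω : Type*} [MeasurableSpace Ω] {P : Measure Ω}
  {d : ℕ} {X : ℤ → Ω → Fin d → ℝ} {g : (Fin d → ℝ) → ℝ}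

lemma IsStationary.integral_mul (hstat : IsStationary P X) (hX : ∀ t, Measurable (X t))
    (hg : Measurable g) {s t : ℕ} (hst : s ≤ t) :
    ∫ ω, g (X (s : ℤ) ω) * g (X (t : ℤ) ω) ∂P =
      ∫ ω, g (X 0 ω) * g (X ((t - s : ℕ) : ℤ) ω) ∂P := by
  rw [← hstat.integral_comp hX (Φ := fun x => g (x 0) * g (x ((t - s : ℕ) : ℤ))) (by fun_prop)
    (s : ℤ)]
  have : ((t - s : ℕ) : ℤ) + s = t := by omega
  simp [this]

variable [IsProbabilityMeasure P]

/-- For fixed `s ∈ A`, distinct `t ≥ s` in `A` have distinct lags, and so do distinct `t < s`; this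
is the factor 2. Only the cardinality of `A` enters, so the bound applies to the scattered indices
that are left between the big blocks. -/
lemma integral_sum_sq_le (hstat : IsStationary P X) (hX : ∀ t, Measurable (X t))
    (hg : Measurable g) {b : ℝ} (hb : ∀ x, |g x| ≤ b) {M : ℕ} {A : Finset ℕ}
    (hA : A ⊆ Finset.range M) :
    ∫ ω, (∑ t ∈ A, g (X (t : ℤ) ω)) ^ 2 ∂P ≤
      A.card * (2 * ∑ h ∈ Finset.range M, |∫ ω, g (X 0 ω) * g (X (h : ℤ) ω) ∂P|) := by
  set γ : ℕ → ℝ := fun h => ∫ ω, g (X 0 ω) * g (X (h : ℤ) ω) ∂P with hγ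
  have hgX : ∀ t, Measurable fun ω => g (X t ω) := fun t => hg.comp (hX t)
  have ii : ∀ s t : ℕ, Integrable (fun ω => g (X (s : ℤ) ω) * g (X (t : ℤ) ω)) P := fun s t =>
    integrable_of_abs_le ((hgX _).mul (hgX _)) (C := b * b) fun ω => by
      rw [abs_mul]
      exact mul_le_mul (hb _) (hb _) (abs_nonneg _) ((abs_nonneg _).trans (hb 0))
  have e : ∫ ω, (∑ t ∈ A, g (X (t : ℤ) ω)) ^ 2 ∂P =
      ∑ s ∈ A, ∑ t ∈ A, ∫ ω, g (X (s : ℤ) ω) * g (X (t : ℤ) ω) ∂P := by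
    simp_rw [sq, Finset.sum_mul_sum]
    rw [integral_finsetSum _ fun s _ => integrable_finsetSum _ fun t _ => ii s t]
    exact Finset.sum_congr rfl fun s _ => integral_finsetSum _ fun t _ => ii s t
  have hsum : ∀ (u : ℕ → ℕ) (B : Finset ℕ), (∀ t ∈ B, u t < M) → Set.InjOn u B →
      ∑ t ∈ B, |γ (u t)| ≤ ∑ h ∈ Finset.range M, |γ h| := by
    intro u B hu hinj
    rw [← Finset.sum_image (f := fun h => |γ h|) hinj]
    refine Finset.sum_le_sum_of_subset_of_nonneg ?_ fun _ _ _ => abs_nonneg _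
    intro x hx
    obtain ⟨t, ht, rfl⟩ := Finset.mem_image.1 hx
    exact Finset.mem_range.2 (hu t ht)
  rw [e, ← nsmul_eq_mul]
  refine Finset.sum_le_card_nsmul _ _ _ fun s hs => ?_
  have hsM := Finset.mem_range.1 (hA hs)
  rw [← Finset.sum_filter_add_sum_filter_not A (fun t => s ≤ t), two_mul]
  refine add_le_add ?_ ?_
  · refine le_trans (Finset.sum_le_sum fun t ht => ?_)
      (hsum (fun t => t - s) (A.filter fun t => s ≤ t) ?_ ?_)
    · rw [hstat.integral_mul hX hg (Finset.mem_filter.1 ht).2]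
      exact le_abs_self _
    · intro t ht
      have := Finset.mem_range.1 (hA (Finset.mem_filter.1 ht).1)
      omega
    · intro t ht t' ht' htt
      have h1 := (Finset.mem_filter.1 (Finset.mem_coe.1 ht)).2
      have h2 := (Finset.mem_filter.1 (Finset.mem_coe.1 ht')).2
      simp only at htt
      omega
  · refine le_trans (Finset.sum_le_sum fun t ht => ?_)
      (hsum (fun t => s - t) (A.filter fun t => ¬ s ≤ t) ?_ ?_)
    · simp_rw [mul_comm (g (X (s : ℤ) _))]
      rw [hstat.integral_mul hX hg (not_le.1 (Finset.mem_filter.1 ht).2).le]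
      exact le_abs_self _
    · intro t ht
      omega
    · intro t ht t' ht' htt
      have h1 := (Finset.mem_filter.1 (Finset.mem_coe.1 ht)).2
      have h2 := (Finset.mem_filter.1 (Finset.mem_coe.1 ht')).2
      simp only at htt
      omega

/-- By induction on `L`: the new index has lags `1, …, L` to the earlier ones, each once. The term
`h = L - 1` has weight zero and is kept only to let the sum run over `range L`. -/
lemma integral_sum_range_sq (hstat : IsStationary P X) (hX : ∀ t, Measurable (X t))
    (hg : Measurable g) {b : ℝ} (hb : ∀ x, |g x| ≤ b) (L : ℕ) :
    ∫ ω, (∑ t ∈ Finset.range L, g (X (t : ℤ) ω)) ^ 2 ∂P =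
      L * ∫ ω, g (X 0 ω) * g (X 0 ω) ∂P + 2 * ∑ h ∈ Finset.range L,
        ((L : ℝ) - (h + 1)) * ∫ ω, g (X 0 ω) * g (X ((h + 1 : ℕ) : ℤ) ω) ∂P := by
  have hgX : ∀ t, Measurable fun ω => g (X t ω) := fun t => hg.comp (hX t)
  have ii : ∀ s t : ℕ, Integrable (fun ω => g (X (s : ℤ) ω) * g (X (t : ℤ) ω)) P := fun s t =>
    integrable_of_abs_le ((hgX _).mul (hgX _)) (C := b * b) fun ω => by
      rw [abs_mul]
      exact mul_le_mul (hb _) (hb _) (abs_nonneg _) ((abs_nonneg _).trans (hb 0))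
  induction L with
  | zero => simp
  | succ L ih =>
    have e : ∀ ω, (∑ t ∈ Finset.range (L + 1), g (X (t : ℤ) ω)) ^ 2 =
        (∑ t ∈ Finset.range L, g (X (t : ℤ) ω)) ^ 2 +
        (2 * ∑ t ∈ Finset.range L, g (X (t : ℤ) ω) * g (X (L : ℤ) ω) +
        g (X (L : ℤ) ω) * g (X (L : ℤ) ω)) := fun ω => by
      rw [Finset.sum_range_succ, ← Finset.sum_mul]; ring
    have i1 : Integrable (fun ω => (∑ t ∈ Finset.range L, g (X (t : ℤ) ω)) ^ 2) P := by
      simp_rw [sq, Finset.sum_mul_sum]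
      exact integrable_finsetSum _ fun s _ => integrable_finsetSum _ fun t _ => ii s t
    have i2 : Integrable (fun ω => ∑ t ∈ Finset.range L, g (X (t : ℤ) ω) * g (X (L : ℤ) ω)) P :=
      integrable_finsetSum _ fun t _ => ii t L
    simp_rw [e]
    have i3 := ii L L
    rw [integral_add (by fun_prop) (by fun_prop), integral_add (by fun_prop) (by fun_prop),
      integral_const_mul, integral_finsetSum _ fun t _ => ii t L, ih,
      hstat.integral_mul hX hg le_rfl]
    have r : ∑ t ∈ Finset.range L, ∫ ω, g (X (t : ℤ) ω) * g (X (L : ℤ) ω) ∂P =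
        ∑ h ∈ Finset.range L, ∫ ω, g (X 0 ω) * g (X ((h + 1 : ℕ) : ℤ) ω) ∂P := by
      -- Reflection turns the index `t` into the lag `L - t`.
      rw [← Finset.sum_range_reflect]
      refine Finset.sum_congr rfl fun t ht => ?_
      have := Finset.mem_range.1 ht
      rw [hstat.integral_mul hX hg (by omega)]
      congr! 5
      omega
    rw [r, Finset.sum_range_succ _ L]
    have r2 : ∀ h : ℕ, ((L + 1 : ℕ) - (h + 1) : ℝ) *
        ∫ ω, g (X 0 ω) * g (X ((h + 1 : ℕ) : ℤ) ω) ∂P =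
        (L - (h + 1) : ℝ) * ∫ ω, g (X 0 ω) * g (X ((h + 1 : ℕ) : ℤ) ω) ∂P +
        ∫ ω, g (X 0 ω) * g (X ((h + 1 : ℕ) : ℤ) ω) ∂P := fun h => by push_cast; ring
    simp_rw [r2]
    rw [Finset.sum_add_distrib]
    simp only [Nat.sub_self, Nat.cast_zero]
    push_cast
    ring

end Covariance

end MixingTail
namespace MixingTail

/-! ### Lipschitz approximation from above -/

section Envelope

variable {K : Type*}

/-- The smallest `k`-Lipschitz function above `G`. -/
noncomputable def upperEnvelope [MetricSpace K] (G : K → ℝ) (k : ℕ) (x : K) : ℝ :=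
  ⨆ y, (G y - k * dist x y)

variable [MetricSpace K] {G : K → ℝ} {C : ℝ}

lemma bddAbove_envelope (hC : ∀ x, |G x| ≤ C) (k : ℕ) (x : K) :
    BddAbove (Set.range fun y => G y - k * dist x y) := by
  refine ⟨C, ?_⟩
  rintro _ ⟨y, rfl⟩
  have h1 := (abs_le.1 (hC y)).2
  have h2 : 0 ≤ (k : ℝ) * dist x y := by positivity
  simp only
  linarith

lemma le_upperEnvelope (hC : ∀ x, |G x| ≤ C) (k : ℕ) (x : K) : G x ≤ upperEnvelope G k x := by
  have := le_ciSup (bddAbove_envelope hC k x) x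
  simp only [dist_self, mul_zero, sub_zero] at this
  exact this

lemma upperEnvelope_le (hC : ∀ x, |G x| ≤ C) (k : ℕ) (x : K) : upperEnvelope G k x ≤ C := by
  have : Nonempty K := ⟨x⟩
  refine ciSup_le fun y => ?_
  have h1 := (abs_le.1 (hC y)).2
  have h2 : 0 ≤ (k : ℝ) * dist x y := by positivity
  linarith

lemma continuous_upperEnvelope (hC : ∀ x, |G x| ≤ C) (k : ℕ) :
    Continuous (upperEnvelope G k) := by
  refine (LipschitzWith.of_le_add_mul (k : NNReal) fun x y => ?_).continuous
  have : Nonempty K := ⟨x⟩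
  refine ciSup_le fun z => ?_
  have h1 := le_ciSup (bddAbove_envelope hC k y) z
  have h2 : dist y z ≤ dist x y + dist x z := by
    rw [dist_comm x y]; exact dist_triangle y x z
  have h3 := mul_le_mul_of_nonneg_left h2 (Nat.cast_nonneg (α := ℝ) k)
  change G z - k * dist x z ≤ (⨆ z, (G z - k * dist y z)) + ((k : NNReal) : ℝ) * dist x y
  push_cast
  linarith

lemma tendsto_upperEnvelope (hC : ∀ x, |G x| ≤ C) {x : K} (hx : ContinuousAt G x) :
    Tendsto (fun k => upperEnvelope G k x) atTop (𝓝 (G x)) := by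
  have : Nonempty K := ⟨x⟩
  refine tendsto_order.2 ⟨fun a ha => Eventually.of_forall fun k =>
    ha.trans_le (le_upperEnvelope hC k x), fun a ha => ?_⟩
  obtain ⟨c, hc1, hc2⟩ := exists_between ha
  obtain ⟨δ, hδ, hball⟩ := Metric.eventually_nhds_iff.1 (hx.eventually (gt_mem_nhds hc1))
  -- With slope above `2 * C / δ`, a point at distance at least `δ` contributes less than `-C`, so
  -- only points near `x` matter for the supremum.
  obtain ⟨n, hn⟩ := exists_nat_gt (2 * C / δ)
  filter_upwards [eventually_ge_atTop n] with k hk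
  refine lt_of_le_of_lt (ciSup_le fun y => ?_) hc2
  by_cases hy : dist y x < δ
  · have h1 := hball hy
    have h2 : 0 ≤ (k : ℝ) * dist x y := by positivity
    linarith
  · have h1 : δ ≤ dist x y := by rw [dist_comm]; exact not_lt.1 hy
    have h2 : (n : ℝ) ≤ k := by exact_mod_cast hk
    have h3 : 2 * C < n * δ := (div_lt_iff₀ hδ).1 hn
    have h4 : (n : ℝ) * δ ≤ k * dist x y := mul_le_mul h2 h1 hδ.le (Nat.cast_nonneg _)
    have h5 := (abs_le.1 (hC y)).2
    have h6 := (abs_le.1 (hC x)).1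
    linarith

end Envelope

/-! ### Vague convergence against almost everywhere continuous functions -/

section Vague

/-- Multiplication by this cutoff makes any continuous function an admissible test function for
vague convergence, without changing it off `U`. -/
lemma exists_cutoff {K : Type*} [TopologicalSpace K] [T2Space K] [CompactSpace K] {z : K}
    {U : Set K} (hU : U ∈ 𝓝 z) :
    ∃ ψ : K → ℝ, Continuous ψ ∧ (∀ x, 0 ≤ ψ x) ∧ (∀ x, ψ x ≤ 1) ∧ (∀ᶠ x in 𝓝 z, ψ x = 0) ∧
      ∀ x ∉ U, ψ x = 1 := by
  obtain ⟨V, hV, hVc, hVU⟩ := exists_mem_nhds_isClosed_subset (interior_mem_nhds.2 hU)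
  obtain ⟨ψ, h0, h1, h01⟩ := exists_continuous_zero_one_of_isClosed hVc
    (isOpen_interior (s := U)).isClosed_compl (Set.disjoint_compl_right_iff_subset.2 hVU)
  refine ⟨ψ, ψ.continuous, fun x => (h01 x).1, fun x => (h01 x).2, ?_, fun x hx => ?_⟩
  · filter_upwards [hV] with x hx using h0 hx
  · exact h1 fun h => hx (interior_subset h)

variable {K : Type*} [TopologicalSpace K] [MeasurableSpace K] [BorelSpace K] {z : K}
  {ν : Measure K}

lemma integrable_of_vanish (hfin : ∀ U ∈ 𝓝 z, ν Uᶜ < ∞) {G : K → ℝ} (hG : Measurable G) {C : ℝ}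
    (hC : ∀ x, |G x| ≤ C) (h0 : ∀ᶠ x in 𝓝 z, G x = 0) : Integrable G ν := by
  obtain ⟨U, hU, hUo, hzU⟩ := eventually_nhds_iff.1 h0
  have : IsFiniteMeasure (ν.restrict Uᶜ) :=
    ⟨by rw [Measure.restrict_apply_univ]; exact hfin U (hUo.mem_nhds hzU)⟩
  have h1 : IntegrableOn G Uᶜ ν := integrable_of_abs_le hG hC
  refine (integrable_indicator_iff hUo.measurableSet.compl).2 h1 |>.congr (ae_of_all _ fun x => ?_)
  by_cases hx : x ∈ U
  · simp [hx, hU x hx]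
  · simp [hx]

variable [CompactSpace K] [TopologicalSpace.MetrizableSpace K]
  {Ω : Type*} [MeasurableSpace Ω] {P : Measure Ω} [IsProbabilityMeasure P]

/-- If the normalized laws of `T x` converge vaguely to `ν` away from `z`, their integrals of a
bounded function that vanishes near `z` and is `ν`-a.e. continuous converge. -/
lemma tendsto_integral_of_null_discontinuity (hfin : ∀ U ∈ 𝓝 z, ν Uᶜ < ∞) {T : ℝ → Ω → K}
    (hT : ∀ x, Measurable (T x)) {p : ℝ → ℝ} (hp : ∀ x, 0 ≤ p x)
    (hlim : ∀ φ : K → ℝ, Continuous φ → (∀ᶠ s in 𝓝 z, φ s = 0) →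
      Tendsto (fun x => (∫ ω, φ (T x ω) ∂P) / p x) atTop (𝓝 (∫ s, φ s ∂ν)))
    {G : K → ℝ} (hG : Measurable G) {C : ℝ} (hC : ∀ x, |G x| ≤ C)
    (h0 : ∀ᶠ s in 𝓝 z, G s = 0) (hdisc : ν {s | ¬ ContinuousAt G s} = 0) :
    Tendsto (fun x => (∫ ω, G (T x ω) ∂P) / p x) atTop (𝓝 (∫ s, G s ∂ν)) := by
  let _ : MetricSpace K := TopologicalSpace.metrizableSpaceMetric K
  obtain ⟨ψ, hψc, hψ0, hψ1, hψz, hψU⟩ := exists_cutoff h0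
  have hψG : ∀ (H : K → ℝ), (∀ s, G s = 0 → H s = 0) → ∀ s, ψ s * H s = H s := by
    intro H hH s
    by_cases hs : G s = 0
    · rw [hH s hs, mul_zero]
    · rw [hψU s hs, one_mul]
  -- The Lipschitz envelopes lie above `H` but need not vanish near `z`, so they are multiplied by
  -- `ψ`, which equals 1 wherever `G` is nonzero. They decrease to `H` at its continuity points,
  -- which are `ν`-almost all, and dominated convergence then allows a single `k` to serve.
  have upper : ∀ H : K → ℝ, Measurable H → (∀ x, |H x| ≤ C) → (∀ s, G s = 0 → H s = 0) →
      ν {s | ¬ ContinuousAt H s} = 0 → ∀ a, ∫ s, H s ∂ν < a →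
      ∀ᶠ x in atTop, (∫ ω, H (T x ω) ∂P) / p x < a := by
    intro H hH hHC hHG hHd a ha
    have hC0 : 0 ≤ C := (abs_nonneg _).trans (hHC z)
    have hEb : ∀ k x, |upperEnvelope H k x| ≤ C := fun k x => abs_le.2
      ⟨(abs_le.1 (hHC x)).1.trans (le_upperEnvelope hHC k x), upperEnvelope_le hHC k x⟩
    have hconv : Tendsto (fun k => ∫ s, ψ s * upperEnvelope H k s ∂ν) atTop (𝓝 (∫ s, H s ∂ν)) := by
      refine tendsto_integral_of_dominated_convergence (fun s => C * ψ s)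
        (fun k => (hψc.mul (continuous_upperEnvelope hHC k)).measurable.aestronglyMeasurable)
        ?_ (fun k => ae_of_all _ fun s => ?_) ?_
      · refine integrable_of_vanish hfin (hψc.measurable.const_mul C) (C := C) (fun s => ?_) ?_
        · rw [abs_of_nonneg (mul_nonneg hC0 (hψ0 s))]
          exact mul_le_of_le_one_right hC0 (hψ1 s)
        · filter_upwards [hψz] with s hs
          rw [hs, mul_zero]
      · rw [Real.norm_eq_abs, abs_mul, abs_of_nonneg (hψ0 s), mul_comm]
        exact mul_le_mul_of_nonneg_right (hEb k s) (hψ0 s)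
      · have : ∀ᵐ s ∂ν, ContinuousAt H s := hHd
        filter_upwards [this] with s hs
        rw [← hψG H hHG s]
        exact (tendsto_upperEnvelope hHC hs).const_mul _
    obtain ⟨k, hk⟩ := (hconv.eventually (gt_mem_nhds ha)).exists
    have := hlim (fun s => ψ s * upperEnvelope H k s)
      (hψc.mul (continuous_upperEnvelope hHC k))
      (by filter_upwards [hψz] with s hs; rw [hs, zero_mul])
    filter_upwards [this.eventually (gt_mem_nhds hk)] with x hx
    refine lt_of_le_of_lt (div_le_div_of_nonneg_right ?_ (hp x)) hx
    refine integral_mono (integrable_of_abs_le (hH.comp (hT x)) fun ω => hHC _)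
      (integrable_of_abs_le (((hψc.mul (continuous_upperEnvelope hHC k)).measurable).comp (hT x))
        (C := C) fun ω => ?_) fun ω => ?_
    · rw [abs_mul, abs_of_nonneg (hψ0 _)]
      exact (mul_le_of_le_one_left (abs_nonneg _) (hψ1 _)).trans (hEb _ _)
    · rw [← hψG H hHG]
      exact mul_le_mul_of_nonneg_left (le_upperEnvelope hHC k _) (hψ0 _)
  -- The lower bound is the upper bound applied to `-G`.
  refine tendsto_order.2 ⟨fun a ha => ?_, fun a ha => upper G hG hC (fun s hs => hs) hdisc a ha⟩
  have hneg : ν {s | ¬ ContinuousAt (fun s => -G s) s} = 0 := by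
    refine measure_mono_null (fun s (hs : ¬ ContinuousAt (fun s => -G s) s) => ?_) hdisc
    exact fun h => hs (ContinuousAt.neg h)
  have := upper (fun s => -G s) hG.neg (fun x => by rw [abs_neg]; exact hC x)
    (fun s hs => by rw [hs, neg_zero]) hneg (-a)
    (by rw [integral_neg]; linarith)
  filter_upwards [this] with x hx
  rw [integral_neg, neg_div] at hx
  linarith

/-- Two measures that are finite away from `z` and agree on the continuous functions vanishing
near `z` have the same null sets away from `z`. -/
lemma measure_eq_zero_of_forall_integral_eq {ν₁ ν₂ : Measure K} (h₁ : ∀ U ∈ 𝓝 z, ν₁ Uᶜ < ∞)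
    (h₂ : ∀ U ∈ 𝓝 z, ν₂ Uᶜ < ∞)
    (h : ∀ φ : K → ℝ, Continuous φ → (∀ᶠ s in 𝓝 z, φ s = 0) → ∫ s, φ s ∂ν₁ = ∫ s, φ s ∂ν₂)
    {D : Set K} (hD : MeasurableSet D) (hDz : Dᶜ ∈ 𝓝 z) (hD1 : ν₁ D = 0) : ν₂ D = 0 := by
  let _ : MetricSpace K := TopologicalSpace.metrizableSpaceMetric K
  obtain ⟨ψ, hψc, hψ0, hψ1, hψz, hψU⟩ := exists_cutoff hDz
  have hψm : Measurable fun s => ENNReal.ofReal (ψ s) := hψc.measurable.ennreal_ofReal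
  -- With density `ψ` the measures become finite, and finite measures are determined by continuous
  -- functions. Since `ψ = 1` on `D`, the mass of `D` is unchanged.
  have fin : ∀ ν : Measure K, (∀ U ∈ 𝓝 z, ν Uᶜ < ∞) →
      IsFiniteMeasure (ν.withDensity fun s => ENNReal.ofReal (ψ s)) := by
    intro ν hν
    refine isFiniteMeasure_withDensity_ofReal (Integrable.hasFiniteIntegral ?_)
    exact integrable_of_vanish hν hψc.measurable (C := 1)
      (fun x => by rw [abs_of_nonneg (hψ0 x)]; exact hψ1 x) hψz
  have := fin ν₁ h₁
  have := fin ν₂ h₂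
  have e : ν₁.withDensity (fun s => ENNReal.ofReal (ψ s)) =
      ν₂.withDensity (fun s => ENNReal.ofReal (ψ s)) := by
    refine ext_of_forall_integral_eq_of_IsFiniteMeasure fun F => ?_
    rw [integral_withDensity_eq_integral_toReal_smul hψm (ae_of_all _ fun _ => ENNReal.ofReal_lt_top),
      integral_withDensity_eq_integral_toReal_smul hψm (ae_of_all _ fun _ => ENNReal.ofReal_lt_top)]
    simp only [ENNReal.toReal_ofReal (hψ0 _), smul_eq_mul]
    refine h (fun s => ψ s * F s) (hψc.mul F.continuous) ?_
    filter_upwards [hψz] with s hs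
    rw [hs, zero_mul]
  have e1 : ∀ ν : Measure K, (ν.withDensity fun s => ENNReal.ofReal (ψ s)) D = ν D := by
    intro ν
    rw [withDensity_apply _ hD, setLIntegral_congr_fun hD (g := fun _ => 1), setLIntegral_one]
    intro s hs
    simp [hψU s (fun h => h hs)]
  rw [← e1, ← e, e1, hD1]

end Vague

/-! ### Limits of the moments of pairs -/

section Pair

variable {Ω : Type*} [MeasurableSpace Ω] {P : Measure Ω}
  {d : ℕ} {N : Seminorm ℝ (Fin d → ℝ)} {X : ℤ → Ω → Fin d → ℝ} {κ : ℝ}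
  {μ : ∀ h : ℕ, Measure (Fin (h + 1) → ExtSpace d)}

lemma continuous_seminorm (N : Seminorm ℝ (Fin d → ℝ)) : Continuous N :=
  continuousOn_univ.1 (N.convexOn.continuousOn isOpen_univ)

@[fun_prop]
lemma measurable_scaled (r : ℝ) : Measurable (scaled r : (Fin d → ℝ) → ExtSpace d) :=
  measurable_pi_lambda _ fun j =>
    measurable_coe_real_ereal.comp (by fun_prop)

/-- A function on `[-∞, ∞]^d` that vanishes on the open unit ball vanishes near `0`. -/
lemma eventually_eq_zero {f : ExtSpace d → ℝ}
    (hf : ∀ x : Fin d → ℝ, N x < 1 → f (fun j => (x j : EReal)) = 0) :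
    ∀ᶠ s in 𝓝 (0 : ExtSpace d), f s = 0 := by
  have h1 : ContinuousAt (fun s : ExtSpace d => fun j => (s j).toReal) 0 := by
    refine continuousAt_pi.2 fun j => ?_
    exact (EReal.tendsto_toReal (a := 0) (by simp) (by simp)).comp (continuous_apply j).continuousAt
  have h2 : ∀ᶠ s in 𝓝 (0 : ExtSpace d), N (fun j => (s j).toReal) < 1 := by
    have : ContinuousAt (fun s : ExtSpace d => N (fun j => (s j).toReal)) 0 :=
      (continuous_seminorm N).continuousAt.comp h1
    refine this.eventually (gt_mem_nhds ?_)
    have : (fun j => ((0 : ExtSpace d) j).toReal) = 0 := by ext j; simp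
    change N (fun j => ((0 : ExtSpace d) j).toReal) < 1
    rw [this, map_zero]
    exact one_pos
  -- `toReal` sends `⊤` and `⊥` to `0`, so finiteness of the coordinates has to be secured
  -- separately before `s` can be identified with a real vector.
  have h3 : ∀ᶠ s in 𝓝 (0 : ExtSpace d), ∀ j, s j ≠ ⊤ ∧ s j ≠ ⊥ := by
    refine eventually_all.2 fun j => ?_
    have hc : ContinuousAt (fun s : ExtSpace d => s j) 0 := (continuous_apply j).continuousAt
    exact (hc.eventually (isOpen_ne.mem_nhds (by simp))).and
      (hc.eventually (isOpen_ne.mem_nhds (by simp)))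
  filter_upwards [h2, h3] with s hs2 hs3
  have : s = fun j => (((s j).toReal : ℝ) : EReal) := by
    ext j; exact (EReal.coe_toReal (hs3 j).1 (hs3 j).2).symm
  rw [this]
  exact hf _ hs2

lemma IsRegularlyVarying.finite_away_map (hRV : IsRegularlyVarying P N X κ μ) {h : ℕ}
    (i : Fin (h + 1)) :
    ∀ U ∈ 𝓝 (0 : ExtSpace d), ((μ h).map fun s => s i) Uᶜ < ∞ := by
  intro U hU
  obtain ⟨V, hVU, hVo, hV0⟩ := mem_nhds_iff.1 hU
  refine lt_of_le_of_lt (measure_mono (Set.compl_subset_compl.2 hVU)) ?_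
  rw [Measure.map_apply (measurable_pi_apply i) hVo.measurableSet.compl]
  exact hRV.finite_away h _ ((continuous_apply i).continuousAt.preimage_mem_nhds
    (hVo.mem_nhds hV0))

lemma measurable_scaled_block (hX : ∀ t, Measurable (X t)) (h : ℕ) (x : ℝ) :
    Measurable fun ω => fun i : Fin (h + 1) => scaled x (X ((i : ℕ) : ℤ) ω) :=
  measurable_pi_lambda _ fun _ => (measurable_scaled x).comp (hX _)

/-- Both integrals are limits of the same normalized expectations, because `X i` and `X 0` have the
same law. -/
lemma IsRegularlyVarying.integral_marginal_eq (hRV : IsRegularlyVarying P N X κ μ)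
    (hstat : IsStationary P X) (hX : ∀ t, Measurable (X t)) {h : ℕ} (i : Fin (h + 1))
    {φ : ExtSpace d → ℝ} (hφ : Continuous φ) (h0 : ∀ᶠ s in 𝓝 0, φ s = 0) :
    ∫ s, φ s ∂(marginalMeasure μ) = ∫ s, φ s ∂((μ h).map fun s => s i) := by
  have ev : ∀ (k : ℕ) (j : Fin (k + 1)), Measurable fun s : Fin (k + 1) → ExtSpace d => s j :=
    fun k j => measurable_pi_apply j
  have ev0 : ∀ (k : ℕ) (j : Fin (k + 1)),
      ∀ᶠ s : Fin (k + 1) → ExtSpace d in 𝓝 0, φ (s j) = 0 := fun k j =>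
    ((continuous_apply j).continuousAt (x := (0 : Fin (k + 1) → ExtSpace d))).eventually h0
  rw [marginalMeasure, integral_map (ev 0 0).aemeasurable
    hφ.measurable.aestronglyMeasurable, integral_map (ev h i).aemeasurable
    hφ.measurable.aestronglyMeasurable]
  have t1 := hRV.tendsto 0 (fun s => φ (s 0)) (by fun_prop) (ev0 0 0)
  have t2 := hRV.tendsto h (fun s => φ (s i)) (by fun_prop) (ev0 h i)
  refine tendsto_nhds_unique t1 (t2.congr fun x => ?_)
  congr 1
  have := hstat.integral_comp hX (Φ := fun y => φ (scaled x (y 0)))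
    (hφ.measurable.comp ((measurable_scaled x).comp (measurable_pi_apply _))) ((i : ℕ) : ℤ)
  simpa using this

lemma tailProb_nonneg (x : ℝ) : 0 ≤ tailProb P N X x := measureReal_nonneg

variable {f g : ExtSpace d → ℝ}

lemma measurableSet_discontinuity (f : ExtSpace d → ℝ) :
    MeasurableSet {x | ¬ ContinuousAt f x} :=
  (IsGδ.setOfPred_continuousAt f).measurableSet.compl

/-- The hypothesis concerns the limit measure of `X 0` only, but away from `0` every marginal of `μ
h` has the same null sets. The discontinuity set does stay away from `0`, since `f` is locally
constant there. -/
lemma IsRegularlyVarying.discontinuity_null (hRV : IsRegularlyVarying P N X κ μ)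
    (hstat : IsStationary P X) (hX : ∀ t, Measurable (X t)) {h : ℕ} (i : Fin (h + 1))
    (hf0 : ∀ᶠ s in 𝓝 0, f s = 0) (hfd : marginalMeasure μ {x | ¬ ContinuousAt f x} = 0) :
    μ h {s | ¬ ContinuousAt f (s i)} = 0 := by
  have := measure_eq_zero_of_forall_integral_eq (hRV.finite_away_map (0 : Fin 1))
    (hRV.finite_away_map i)
    (fun φ hφ h0 => hRV.integral_marginal_eq hstat hX i hφ h0) (measurableSet_discontinuity f)
    (by
      filter_upwards [hf0.eventually_nhds] with s hs
      simp only [Set.mem_compl_iff, Set.mem_ofPred_eq, not_not]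
      exact (continuousAt_const (y := (0 : ℝ))).congr (hs.mono fun _ h => h.symm)) hfd
  rwa [Measure.map_apply (measurable_pi_apply i) (measurableSet_discontinuity f)] at this

lemma integrable_pair_block (hRV : IsRegularlyVarying P N X κ μ) (hf : Measurable f)
    (hg : Measurable g) {C D : ℝ} (hfC : ∀ x, |f x| ≤ C) (hgD : ∀ x, |g x| ≤ D)
    (hf0 : ∀ᶠ s in 𝓝 0, f s = 0) (h : ℕ) :
    Integrable (fun s => f (s 0) * g (s (Fin.last h))) (μ h) := by
  refine integrable_of_vanish (z := 0) (hRV.finite_away h)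
    (by fun_prop)
    (C := C * D) (fun s => ?_) ?_
  · rw [abs_mul]
    exact mul_le_mul (hfC _) (hgD _) (abs_nonneg _) ((abs_nonneg _).trans (hfC 0))
  · have := (continuous_apply (0 : Fin (h + 1))).continuousAt
      (x := (0 : Fin (h + 1) → ExtSpace d)) |>.eventually hf0
    filter_upwards [this] with s hs
    simp [hs]

/-- The product vanishes near the origin of the block space, and its discontinuities lie in the
union of two null cylinder sets, so the extended vague convergence applies. -/
lemma IsRegularlyVarying.tendsto_pair [IsProbabilityMeasure P] (hRV : IsRegularlyVarying P N X κ μ)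
    (hstat : IsStationary P X) (hX : ∀ t, Measurable (X t)) (hf : Measurable f)
    (hg : Measurable g) {C D : ℝ} (hfC : ∀ x, |f x| ≤ C) (hgD : ∀ x, |g x| ≤ D)
    (hf0 : ∀ᶠ s in 𝓝 0, f s = 0) (hg0 : ∀ᶠ s in 𝓝 0, g s = 0)
    (hfd : marginalMeasure μ {x | ¬ ContinuousAt f x} = 0)
    (hgd : marginalMeasure μ {x | ¬ ContinuousAt g x} = 0) (h : ℕ) :
    Tendsto (fun x : ℝ => (∫ ω, f (scaled x (X 0 ω)) * g (scaled x (X (h : ℤ) ω)) ∂P) /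
      tailProb P N X x) atTop (𝓝 (∫ s, f (s 0) * g (s (Fin.last h)) ∂(μ h))) := by
  have key := tendsto_integral_of_null_discontinuity (P := P) (z := 0) (hRV.finite_away h)
    (T := fun x ω => fun i : Fin (h + 1) => scaled x (X ((i : ℕ) : ℤ) ω))
    (measurable_scaled_block hX h) (p := tailProb P N X) tailProb_nonneg (hRV.tendsto h)
    (G := fun s => f (s 0) * g (s (Fin.last h)))
    (by fun_prop)
    (C := C * D) (fun s => ?_) ?_ ?_
  · simpa using key
  · rw [abs_mul]
    exact mul_le_mul (hfC _) (hgD _) (abs_nonneg _) ((abs_nonneg _).trans (hfC 0))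
  · have := (continuous_apply (0 : Fin (h + 1))).continuousAt
      (x := (0 : Fin (h + 1) → ExtSpace d)) |>.eventually hf0
    filter_upwards [this] with s hs
    simp [hs]
  · refine measure_mono_null (fun s hs => ?_) (measure_union_null
      (hRV.discontinuity_null hstat hX (0 : Fin (h + 1)) hf0 hfd)
      (hRV.discontinuity_null hstat hX (Fin.last h) hg0 hgd))
    by_contra hcon
    simp only [Set.mem_union, Set.mem_ofPred_eq, not_or, not_not] at hcon
    refine hs ?_
    exact (hcon.1.comp (f := fun s : Fin (h + 1) → ExtSpace d => s 0)
      (continuous_apply _).continuousAt).mul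
      (hcon.2.comp (f := fun s : Fin (h + 1) → ExtSpace d => s (Fin.last h))
      (continuous_apply _).continuousAt)

lemma measurable_pairMap (h : ℕ) :
    Measurable fun s : Fin (h + 1) → ExtSpace d => (s 0, s (Fin.last h)) :=
  (measurable_pi_apply _).prodMk (measurable_pi_apply _)

lemma integrable_pairMeasure_of {F : ExtSpace d × ExtSpace d → ℝ} (hF : Measurable F) {h : ℕ}
    (hi : Integrable (fun s => F (s 0, s (Fin.last h))) (μ h)) :
    Integrable F (pairMeasure μ h) := by
  refine Integrable.restrict ?_
  exact (integrable_map_measure hF.aestronglyMeasurable (measurable_pairMap h).aemeasurable).2 hi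

lemma integral_pairMeasure {F : ExtSpace d × ExtSpace d → ℝ} (hF : Measurable F) (h0 : F 0 = 0)
    (h : ℕ) : ∫ z, F z ∂(pairMeasure μ h) = ∫ s, F (s 0, s (Fin.last h)) ∂(μ h) := by
  rw [pairMeasure, setIntegral_eq_integral_of_forall_compl_eq_zero,
    integral_map (measurable_pairMap h).aemeasurable hF.aestronglyMeasurable]
  intro z hz
  have : z = 0 := by simpa using hz
  rw [this, h0]

end Pair

end MixingTail
namespace MixingTail

/-! ### Series limits with uniformly small tails -/

section Tannery

variable {b : ℕ → ℕ → ℝ} {c : ℕ → ℝ}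

lemma exists_bound_of_uniform_tail (hb : ∀ h, Tendsto (fun n => b n h) atTop (𝓝 (c h)))
    (htail : ∀ ε > 0, ∃ H, ∀ᶠ n in atTop, ∀ M, ∑ h ∈ Finset.Ico H M, |b n h| ≤ ε) :
    ∃ K, 0 < K ∧ ∀ᶠ n in atTop, ∀ M, ∑ h ∈ Finset.range M, |b n h| ≤ K := by
  obtain ⟨H, hH⟩ := htail 1 one_pos
  have h1 : Tendsto (fun n => ∑ h ∈ Finset.range H, |b n h|) atTop
      (𝓝 (∑ h ∈ Finset.range H, |c h|)) := tendsto_finsetSum _ fun h _ => (hb h).abs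
  refine ⟨∑ h ∈ Finset.range H, |c h| + 1 + 1, ?_, ?_⟩
  · have : 0 ≤ ∑ h ∈ Finset.range H, |c h| := Finset.sum_nonneg fun _ _ => abs_nonneg _
    linarith
  · filter_upwards [hH, h1.eventually (gt_mem_nhds (lt_add_one _))] with n hn1 hn2 M
    have : ∑ h ∈ Finset.range M, |b n h| ≤
        ∑ h ∈ Finset.range H, |b n h| + ∑ h ∈ Finset.Ico H M, |b n h| := by
      rw [← Finset.sum_union]
      · refine Finset.sum_le_sum_of_subset_of_nonneg ?_ fun _ _ _ => abs_nonneg _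
        intro x hx
        simp only [Finset.mem_range, Finset.mem_union, Finset.mem_Ico] at hx ⊢
        omega
      · rw [Finset.disjoint_left]
        intro x hx hx'
        simp only [Finset.mem_range, Finset.mem_Ico] at hx hx'
        omega
    linarith [hn1 M]

lemma summable_of_uniform_tail (hb : ∀ h, Tendsto (fun n => b n h) atTop (𝓝 (c h)))
    (htail : ∀ ε > 0, ∃ H, ∀ᶠ n in atTop, ∀ M, ∑ h ∈ Finset.Ico H M, |b n h| ≤ ε) :
    Summable c := by
  obtain ⟨K, -, hK⟩ := exists_bound_of_uniform_tail hb htail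
  refine Summable.of_abs (summable_of_sum_range_le (c := K) (fun _ => abs_nonneg _) fun M => ?_)
  exact le_of_tendsto (tendsto_finsetSum (Finset.range M) fun h _ => (hb h).abs)
    (hK.mono fun n hn => hn M)

/-- A Tannery theorem in which uniform smallness of the tails replaces a dominating series. The cut
`J` lies beyond the uniform tail index and is large enough for the limit series too; the finite part
up to `J` converges term by term. -/
lemma tendsto_sum_of_uniform_tail (hb : ∀ h, Tendsto (fun n => b n h) atTop (𝓝 (c h)))
    (htail : ∀ ε > 0, ∃ H, ∀ᶠ n in atTop, ∀ M, ∑ h ∈ Finset.Ico H M, |b n h| ≤ ε)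
    {M : ℕ → ℕ} (hM : Tendsto M atTop atTop) :
    Tendsto (fun n => ∑ h ∈ Finset.range (M n), b n h) atTop (𝓝 (∑' h, c h)) := by
  have hs := summable_of_uniform_tail hb htail
  refine Metric.tendsto_nhds.2 fun ε hε => ?_
  obtain ⟨H, hH⟩ := htail (ε / 4) (by positivity)
  obtain ⟨J, hJ, hHJ⟩ := ((Metric.tendsto_nhds.1 hs.hasSum.tendsto_sum_nat (ε / 4)
    (by positivity)).and (eventually_ge_atTop H)).exists
  have hJt : Tendsto (fun n => ∑ h ∈ Finset.range J, b n h) atTop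
      (𝓝 (∑ h ∈ Finset.range J, c h)) := tendsto_finsetSum _ fun h _ => hb h
  filter_upwards [hH, Metric.tendsto_nhds.1 hJt (ε / 4) (by positivity),
    hM.eventually_ge_atTop J] with n h1 h2 h3
  have h4 : dist (∑ h ∈ Finset.range (M n), b n h) (∑ h ∈ Finset.range J, b n h) ≤ ε / 4 := by
    rw [Real.dist_eq, ← Finset.sum_Ico_eq_sub _ h3]
    refine (Finset.abs_sum_le_sum_abs _ _).trans (le_trans ?_ (h1 (M n)))
    exact Finset.sum_le_sum_of_subset_of_nonneg (Finset.Ico_subset_Ico_left hHJ)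
      fun _ _ _ => abs_nonneg _
  have h5 := dist_triangle4 (∑ h ∈ Finset.range (M n), b n h) (∑ h ∈ Finset.range J, b n h)
    (∑ h ∈ Finset.range J, c h) (∑' h, c h)
  linarith

end Tannery

/-! ### Bounds for one covariance -/

section Bounds

variable {Ω : Type*} [MeasurableSpace Ω] {P : Measure Ω}
  {d : ℕ} {N : Seminorm ℝ (Fin d → ℝ)} {X : ℤ → Ω → Fin d → ℝ}

/-- The covariance of `F (X 0)` and `G (X h)`. -/
noncomputable def seriesCov (P : Measure Ω) (X : ℤ → Ω → Fin d → ℝ) (F G : (Fin d → ℝ) → ℝ)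
    (h : ℕ) : ℝ :=
  ∫ ω, F (X 0 ω) * G (X (h : ℤ) ω) ∂P - (∫ ω, F (X 0 ω) ∂P) * ∫ ω, G (X 0 ω) ∂P

variable {F G : (Fin d → ℝ) → ℝ} {C r : ℝ}

lemma IsStationary.ae_eq_zero (hstat : IsStationary P X) (hX : ∀ t, Measurable (X t))
    (hF : Measurable F) (h0 : ∀ᵐ ω ∂P, ¬ r < N (X 0 ω) → F (X 0 ω) = 0) (t : ℤ) :
    ∀ᵐ ω ∂P, ¬ r < N (X t ω) → F (X t ω) = 0 := by
  have id : IdentDistrib (fun ω => X t ω) (fun ω => X 0 ω) P P := by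
    simpa using hstat.identDistrib_comp hX (Φ := fun x => x 0) (measurable_pi_apply _) t
  have hm : MeasurableSet {x : Fin d → ℝ | ¬ r < N x → F x = 0} := by
    have e : {x : Fin d → ℝ | ¬ r < N x → F x = 0} = {x | r < N x} ∪ {x | F x = 0} := by
      ext x; simp only [Set.mem_ofPred_eq, Set.mem_union]; tauto
    rw [e]
    exact (measurableSet_lt measurable_const (continuous_seminorm N).measurable).union
      (hF (measurableSet_singleton 0))
  exact id.symm.ae_snd hm h0

variable [IsProbabilityMeasure P]

lemma measurableSet_exceed (hX : ∀ t, Measurable (X t)) (r : ℝ) (t : ℤ) :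
    MeasurableSet {ω | r < N (X t ω)} :=
  measurableSet_lt measurable_const ((continuous_seminorm N).measurable.comp (hX t))

lemma abs_integral_le_tailProb (hX : ∀ t, Measurable (X t)) (hF : Measurable F)
    (hFC : ∀ x, |F x| ≤ C) (h0 : ∀ᵐ ω ∂P, ¬ r < N (X 0 ω) → F (X 0 ω) = 0) :
    |∫ ω, F (X 0 ω) ∂P| ≤ C * tailProb P N X r := by
  have hm := measurableSet_exceed (N := N) hX r 0
  calc |∫ ω, F (X 0 ω) ∂P| ≤ ∫ ω, |F (X 0 ω)| ∂P := abs_integral_le_integral_abs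
    _ ≤ ∫ ω, {ω | r < N (X 0 ω)}.indicator (fun _ => C) ω ∂P := by
      refine integral_mono_ae (integrable_of_abs_le (hF.comp (hX 0)) fun ω => hFC _).abs
        ((integrable_const C).indicator hm) ?_
      filter_upwards [h0] with ω hω
      by_cases h : r < N (X 0 ω)
      · rw [Set.indicator_of_mem (by exact h)]; exact hFC _
      · rw [Set.indicator_of_notMem (by exact h), hω h, abs_zero]
    _ = C * tailProb P N X r := by
      rw [integral_indicator_const _ hm, smul_eq_mul, mul_comm, tailProb]

lemma IsStationary.abs_integral_mul_le (hstat : IsStationary P X) (hX : ∀ t, Measurable (X t))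
    (hF : Measurable F) (hG : Measurable G) (hFC : ∀ x, |F x| ≤ C) (hGC : ∀ x, |G x| ≤ C)
    (hF0 : ∀ᵐ ω ∂P, ¬ r < N (X 0 ω) → F (X 0 ω) = 0)
    (hG0 : ∀ᵐ ω ∂P, ¬ r < N (X 0 ω) → G (X 0 ω) = 0) (h : ℕ) :
    |∫ ω, F (X 0 ω) * G (X (h : ℤ) ω) ∂P| ≤
      C ^ 2 * P.real {ω | r < N (X 0 ω) ∧ r < N (X (h : ℤ) ω)} := by
  have hm := (measurableSet_exceed (N := N) hX r 0).inter (measurableSet_exceed (N := N) hX r h)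
  have hb : ∀ x y, |F x * G y| ≤ C ^ 2 := fun x y => by
    rw [abs_mul, sq]
    exact mul_le_mul (hFC x) (hGC y) (abs_nonneg _) ((abs_nonneg _).trans (hFC x))
  calc |∫ ω, F (X 0 ω) * G (X (h : ℤ) ω) ∂P| ≤ ∫ ω, |F (X 0 ω) * G (X (h : ℤ) ω)| ∂P :=
        abs_integral_le_integral_abs
    _ ≤ ∫ ω, ({ω | r < N (X 0 ω)} ∩ {ω | r < N (X (h : ℤ) ω)}).indicator (fun _ => C ^ 2) ω ∂P := by
      refine integral_mono_ae (integrable_of_abs_le ((hF.comp (hX 0)).mul (hG.comp (hX h)))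
        fun ω => hb _ _).abs ((integrable_const _).indicator hm) ?_
      filter_upwards [hF0, hstat.ae_eq_zero hX hG hG0 h] with ω hω hω'
      by_cases h1 : r < N (X 0 ω)
      · by_cases h2 : r < N (X (h : ℤ) ω)
        · rw [Set.indicator_of_mem (by exact ⟨h1, h2⟩)]; exact hb _ _
        · rw [Set.indicator_of_notMem (fun hh => h2 hh.2), hω' h2, mul_zero, abs_zero]
      · rw [Set.indicator_of_notMem (fun hh => h1 hh.1), hω h1, zero_mul, abs_zero]
    _ = C ^ 2 * P.real {ω | r < N (X 0 ω) ∧ r < N (X (h : ℤ) ω)} := by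
      rw [integral_indicator_const _ hm, smul_eq_mul, mul_comm]
      rfl

lemma IsStationary.abs_seriesCov_le (hstat : IsStationary P X) (hX : ∀ t, Measurable (X t))
    (hF : Measurable F) (hG : Measurable G) (hFC : ∀ x, |F x| ≤ C) (hGC : ∀ x, |G x| ≤ C)
    (hF0 : ∀ᵐ ω ∂P, ¬ r < N (X 0 ω) → F (X 0 ω) = 0)
    (hG0 : ∀ᵐ ω ∂P, ¬ r < N (X 0 ω) → G (X 0 ω) = 0) (h : ℕ) :
    |seriesCov P X F G h| ≤ C ^ 2 * (P.real {ω | r < N (X 0 ω) ∧ r < N (X (h : ℤ) ω)} +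
      tailProb P N X r ^ 2) := by
  have h1 := hstat.abs_integral_mul_le hX hF hG hFC hGC hF0 hG0 h
  have h2 := abs_integral_le_tailProb hX hF hFC hF0
  have h3 := abs_integral_le_tailProb hX hG hGC hG0
  have h4 := mul_le_mul h2 h3 (abs_nonneg _) ((abs_nonneg _).trans h2)
  rw [← abs_mul] at h4
  refine (abs_sub _ _).trans ?_
  rw [mul_add]
  refine add_le_add h1 (h4.trans (le_of_eq ?_))
  ring

lemma IsStationary.abs_seriesCov_le_mixing (hstat : IsStationary P X)
    (hX : ∀ t, Measurable (X t)) (hF : Measurable F) (hG : Measurable G) (hC : 0 < C)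
    (hFC : ∀ x, |F x| ≤ C) (hGC : ∀ x, |G x| ≤ C) (h : ℕ) :
    |seriesCov P X F G h| ≤ 4 * C ^ 2 * mixingCoeff P X h := by
  have key := abs_cov_le (P := P) (sigmaAlg_le hX {s | s ≤ (0 : ℤ)})
    (sigmaAlg_le hX {s | (0 : ℤ) + h ≤ s})
    (fun A B hA hB => hstat.abs_sub_le_mixingCoeff hX 0 h hA hB)
    (U := fun ω => F (X 0 ω)) (V := fun ω => G (X (h : ℤ) ω))
    (hF.comp (measurable_sigmaAlg (by simp)))
    (hG.comp (measurable_sigmaAlg (by simp))) hC hC (fun ω => hFC _) (fun ω => hGC _)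
  have e : ∫ ω, G (X (h : ℤ) ω) ∂P = ∫ ω, G (X 0 ω) ∂P := by
    simpa using hstat.integral_comp hX (Φ := fun x => G (x 0)) (by fun_prop) (h : ℤ)
  rw [e] at key
  exact key.trans (le_of_eq (by ring))

/-- Interpolation between the moment bound and the mixing bound. -/
lemma IsStationary.abs_seriesCov_div_le (hstat : IsStationary P X)
    (hX : ∀ t, Measurable (X t)) (hF : Measurable F) (hG : Measurable G) (hC : 0 < C)
    (hFC : ∀ x, |F x| ≤ C) (hGC : ∀ x, |G x| ≤ C)
    (hF0 : ∀ᵐ ω ∂P, ¬ r < N (X 0 ω) → F (X 0 ω) = 0)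
    (hG0 : ∀ᵐ ω ∂P, ¬ r < N (X 0 ω) → G (X 0 ω) = 0) (hp : 0 < tailProb P N X r)
    {δ : ℝ} (hδ0 : 0 < δ) (hδ1 : δ < 1) (h : ℕ) :
    |seriesCov P X F G h| / tailProb P N X r ≤
      4 * C ^ 2 * ((1 / tailProb P N X r) ^ δ * mixingCoeff P X h ^ δ) := by
  set p := tailProb P N X r with hpdef
  have hα := mixingCoeff_nonneg P X h
  set a := mixingCoeff P X h with ha
  have hp1 : p ≤ 1 := measureReal_le_one
  have h1 := hstat.abs_seriesCov_le hX hF hG hFC hGC hF0 hG0 h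
  have h2 := hstat.abs_seriesCov_le_mixing hX hF hG hC hFC hGC h
  have h3 : P.real {ω | r < N (X 0 ω) ∧ r < N (X (h : ℤ) ω)} ≤ p :=
    measureReal_mono fun ω hω => hω.1
  rw [← Real.mul_rpow (by positivity) hα, one_div_mul_eq_div]
  have hC2 : 0 < C ^ 2 := by positivity
  have h4 : |seriesCov P X F G h| / p ≤ 4 * C ^ 2 * (a / p) := by
    rw [← mul_div_assoc]; exact div_le_div_of_nonneg_right h2 hp.le
  have h5 : |seriesCov P X F G h| / p ≤ 4 * C ^ 2 := by
    rw [div_le_iff₀ hp]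
    have : p ^ 2 ≤ p := by nlinarith
    nlinarith
  have hap : 0 ≤ a / p := div_nonneg hα hp.le
  -- For every `δ ∈ (0, 1)` and `x ≥ 0`, `min 1 x ≤ x ^ δ`; here `x = a / p`.
  rcases le_total (a / p) 1 with hle | hle
  · refine h4.trans (mul_le_mul_of_nonneg_left ?_ (by positivity))
    rcases hap.eq_or_lt with h0 | h0
    · rw [← h0, Real.zero_rpow hδ0.ne']
    · calc a / p = (a / p) ^ (1 : ℝ) := (Real.rpow_one _).symm
        _ ≤ (a / p) ^ δ := Real.rpow_le_rpow_of_exponent_ge h0 hle hδ1.le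
  · refine h5.trans ?_
    have := Real.one_le_rpow hle hδ0.le
    nlinarith

end Bounds

/-! ### Uniform negligibility of large lags -/

section Tail

variable {Ω : Type*} [MeasurableSpace Ω] {P : Measure Ω} [IsProbabilityMeasure P]
  {d : ℕ} {N : Seminorm ℝ (Fin d → ℝ)} {X : ℤ → Ω → Fin d → ℝ} {κ : ℝ}
  {μ : ∀ h : ℕ, Measure (Fin (h + 1) → ExtSpace d)}

lemma tendsto_tailProb (hX : ∀ t, Measurable (X t)) :
    Tendsto (tailProb P N X) atTop (𝓝 0) := by
  have hm : Measurable fun ω => N (X 0 ω) := (continuous_seminorm N).measurable.comp (hX 0)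
  have : IsProbabilityMeasure (P.map fun ω => N (X 0 ω)) :=
    Measure.isProbabilityMeasure_map hm.aemeasurable
  have h1 := tendsto_cdf_atTop (P.map fun ω => N (X 0 ω))
  have e : ∀ x, tailProb P N X x = 1 - cdf (P.map fun ω => N (X 0 ω)) x := by
    intro x
    rw [cdf_eq_real, map_measureReal_apply hm measurableSet_Iic, tailProb,
      ← probReal_compl_eq_one_sub (hm measurableSet_Iic)]
    congr 1
    ext ω
    simp
  simp_rw [funext e]
  simpa using h1.const_sub 1

/-- If the tail vanished at some level, it would vanish beyond it, and `μ 0` would integrate every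
test function to zero. It would then have no mass away from the origin, nor at the origin, contrary
to `ne_zero`. -/
lemma IsRegularlyVarying.tailProb_pos (hRV : IsRegularlyVarying P N X κ μ) (x : ℝ) :
    0 < tailProb P N X x := by
  refine lt_of_le_of_ne (tailProb_nonneg x) fun h0 => ?_
  have hz : ∀ y ≥ x, tailProb P N X y = 0 := fun y hy =>
    le_antisymm (h0 ▸ measureReal_mono fun ω (hω : y < N (X 0 ω)) => lt_of_le_of_lt hy hω)
      (tailProb_nonneg y)
  have hint : ∀ φ : (Fin (0 + 1) → ExtSpace d) → ℝ, Continuous φ →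
      (∀ᶠ s in 𝓝 (0 : Fin (0 + 1) → ExtSpace d), φ s = 0) → ∫ s, φ s ∂(μ 0) = 0 := by
    intro φ hφ hφ0
    refine tendsto_nhds_unique (hRV.tendsto 0 φ hφ hφ0)
      (tendsto_const_nhds.congr' ?_)
    filter_upwards [eventually_ge_atTop x] with y hy
    -- The normalized expectations are `0` here by the convention for division by zero.
    rw [hz y hy, div_zero]
  refine hRV.ne_zero 0 ?_
  have hU : ∀ U ∈ 𝓝 (0 : Fin (0 + 1) → ExtSpace d), μ 0 Uᶜ = 0 := by
    intro U hU
    obtain ⟨V, hVU, hVo, hV0⟩ := mem_nhds_iff.1 hU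
    refine measure_mono_null (Set.compl_subset_compl.2 hVU) ?_
    refine measure_eq_zero_of_forall_integral_eq (z := 0) (ν₁ := 0) (by simp)
      (hRV.finite_away 0) (fun φ h1 h2 => ?_) hVo.measurableSet.compl ?_ (by simp)
    · rw [hint φ h1 h2]; simp
    · rw [compl_compl]; exact hVo.mem_nhds hV0
  obtain ⟨u, hu, hu'⟩ := (𝓝 (0 : Fin (0 + 1) → ExtSpace d)).exists_antitone_basis
  have h2 : (⋃ n, (u n)ᶜ) ∪ {0} = (Set.univ : Set (Fin (0 + 1) → ExtSpace d)) := by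
    refine Set.eq_univ_of_forall fun s => ?_
    by_cases hs : s = 0
    · exact Or.inr hs
    · obtain ⟨n, -, hn⟩ := hu.mem_iff.1 (isOpen_compl_singleton.mem_nhds (fun h : 0 ∈ ({s} : Set _) =>
        hs (Set.mem_singleton_iff.1 h).symm))
      exact Or.inl (Set.mem_iUnion.2 ⟨n, fun h => hn h rfl⟩)
  rw [← Measure.measure_univ_eq_zero, ← h2]
  exact measure_union_null (measure_iUnion_null fun n => hU _ (hu.mem_of_mem trivial))
    (hRV.no_mass_at_zero 0)

variable {r : ℕ → ℝ} {f g : ExtSpace d → ℝ} {C : ℝ}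

/-- The normalized covariances at large lags are uniformly negligible. -/
lemma exists_tail_bound (hX : ∀ t, Measurable (X t)) (hstat : IsStationary P X)
    (hRV : IsRegularlyVarying P N X κ μ) (hM : ConditionM P N X r)
    (hf : Measurable f) (hg : Measurable g) (hC : 0 < C) (hfC : ∀ x, |f x| ≤ C)
    (hgC : ∀ x, |g x| ≤ C)
    (hf0 : ∀ᶠ n in atTop, ∀ᵐ ω ∂P, ¬ r n < N (X 0 ω) → f (scaled (r n) (X 0 ω)) = 0)
    (hg0 : ∀ᶠ n in atTop, ∀ᵐ ω ∂P, ¬ r n < N (X 0 ω) → g (scaled (r n) (X 0 ω)) = 0) :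
    ∀ ε > 0, ∃ H, ∀ᶠ n in atTop, ∀ M, ∑ h ∈ Finset.Ico H M,
      |seriesCov P X (fun x => f (scaled (r n) x)) (fun x => g (scaled (r n) x)) h /
        tailProb P N X (r n)| ≤ ε := by
  obtain ⟨-, l, hl, hlp, ⟨δ, hδ0, hδ1, hi⟩, hii, -⟩ := hM
  intro ε hε
  -- The lags up to `l n` will contribute at most `3 * C ^ 2 * η` and the others at most `4 * C ^ 2
  -- * η`.
  set η : ℝ := ε / (12 * C ^ 2) with hη
  have hη0 : 0 < η := by positivity
  obtain ⟨H, hH⟩ := (hii.eventually (gt_mem_nhds (ENNReal.ofReal_pos.2 hη0))).exists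
  refine ⟨H, ?_⟩
  have hp0 := hRV.tailProb_pos
  have e2 := eventually_lt_of_limsup_lt hH
  have e1 := hi.eventually (gt_mem_nhds (ENNReal.ofReal_pos.2 hη0))
  have e3 := hlp.eventually (gt_mem_nhds hη0)
  filter_upwards [e1, e2, e3, hf0, hg0, hl.eventually_ge_atTop 1] with n h1 h2 h3 hfn hgn hln M
  set p := tailProb P N X (r n) with hp
  have hpn : 0 < p := hp0 _
  have hp1 : p ≤ 1 := measureReal_le_one
  set a : ℕ → ℝ := fun h =>
    |seriesCov P X (fun x => f (scaled (r n) x)) (fun x => g (scaled (r n) x)) h / p| with ha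
  set q : ℕ → ℝ := fun j => P.real {ω | r n < N (X 0 ω) ∧ r n < N (X (j : ℤ) ω)} with hq
  have mF : Measurable fun x => f (scaled (r n) x) := hf.comp (measurable_scaled _)
  have mG : Measurable fun x => g (scaled (r n) x) := hg.comp (measurable_scaled _)
  have ba : ∀ h, a h ≤ C ^ 2 * (q h / p + p) := by
    intro h
    have := hstat.abs_seriesCov_le hX mF mG (fun x => hfC _) (fun x => hgC _) hfn hgn h
    simp only [ha]
    rw [abs_div, abs_of_pos hpn, div_le_iff₀ hpn]
    refine this.trans (le_of_eq ?_)
    rw [mul_assoc, add_mul, div_mul_cancel₀ _ hpn.ne', sq p]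
  have bb : ∀ h, a h ≤ 4 * C ^ 2 * ((1 / p) ^ δ * mixingCoeff P X h ^ δ) := by
    intro h
    simp only [ha]
    rw [abs_div, abs_of_pos hpn]
    exact hstat.abs_seriesCov_div_le hX mF mG hC (fun x => hfC _) (fun x => hgC _) hfn hgn hpn
      hδ0 hδ1 h
  have s1 : (∑ j ∈ Finset.Icc H (l n), q j) / p < η := by
    have e : (ENNReal.ofReal p)⁻¹ *
        ∑ j ∈ Finset.Icc H (l n), P {ω | r n < N (X 0 ω) ∧ r n < N (X (j : ℤ) ω)} =
        ENNReal.ofReal ((∑ j ∈ Finset.Icc H (l n), q j) / p) := by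
      rw [ENNReal.ofReal_div_of_pos hpn, ENNReal.ofReal_sum_of_nonneg fun _ _ => measureReal_nonneg,
        ENNReal.div_eq_inv_mul]
      congr 1
      exact Finset.sum_congr rfl fun j _ => (ofReal_measureReal (measure_ne_top _ _)).symm
    rw [e] at h2
    exact (ENNReal.ofReal_lt_ofReal_iff hη0).1 h2
  have s2 : ∀ B : Finset ℕ, (∀ h ∈ B, l n ≤ h) →
      (1 / p) ^ δ * ∑ h ∈ B, mixingCoeff P X h ^ δ ≤ η := by
    intro B hB
    have hinj : Set.InjOn (fun h => h - l n) B := by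
      intro x hx y hy hxy
      have := hB x hx
      have := hB y hy
      simp only at hxy
      omega
    have e : ENNReal.ofReal (∑ h ∈ B, mixingCoeff P X h ^ δ) ≤
        ∑' k : ℕ, ENNReal.ofReal (mixingCoeff P X (l n + k) ^ δ) := by
      rw [ENNReal.ofReal_sum_of_nonneg fun h _ => Real.rpow_nonneg (mixingCoeff_nonneg P X h) δ]
      refine le_trans (le_of_eq ?_) (ENNReal.sum_le_tsum (B.image fun h => h - l n))
      rw [Finset.sum_image hinj]
      refine Finset.sum_congr rfl fun h hh => ?_
      rw [Nat.add_sub_cancel' (hB h hh)]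
    have : ENNReal.ofReal ((1 / p) ^ δ * ∑ h ∈ B, mixingCoeff P X h ^ δ) ≤ ENNReal.ofReal η := by
      rw [ENNReal.ofReal_mul (by positivity)]
      exact (mul_le_mul_right e _).trans h1.le
    exact (ENNReal.ofReal_le_ofReal_iff hη0.le).1 this
  -- Up to `l n` the moment bound is summed, using (ii) for the joint exceedances and `l n * p → 0`
  -- for the product of the means; beyond `l n` the interpolated mixing bound is summed, using (i).
  rw [← Finset.sum_filter_add_sum_filter_not (Finset.Ico H M) (fun h => h ≤ l n)]
  have t1 : ∑ h ∈ (Finset.Ico H M).filter (fun h => h ≤ l n), a h ≤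
      C ^ 2 * (η + 2 * η) := by
    calc ∑ h ∈ (Finset.Ico H M).filter (fun h => h ≤ l n), a h
        ≤ ∑ h ∈ Finset.Icc H (l n), a h := by
          refine Finset.sum_le_sum_of_subset_of_nonneg ?_ fun _ _ _ => abs_nonneg _
          intro x hx
          simp only [Finset.mem_filter, Finset.mem_Ico, Finset.mem_Icc] at hx ⊢
          omega
      _ ≤ ∑ h ∈ Finset.Icc H (l n), C ^ 2 * (q h / p + p) := Finset.sum_le_sum fun h _ => ba h
      _ = C ^ 2 * ((∑ j ∈ Finset.Icc H (l n), q j) / p + (Finset.Icc H (l n)).card * p) := by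
          rw [← Finset.mul_sum, Finset.sum_add_distrib, Finset.sum_div, Finset.sum_const,
            nsmul_eq_mul]
      _ ≤ C ^ 2 * (η + 2 * η) := by
          refine mul_le_mul_of_nonneg_left (add_le_add s1.le ?_) (by positivity)
          have hc : ((Finset.Icc H (l n)).card : ℝ) ≤ 2 * l n := by
            rw [Nat.card_Icc]
            have : l n + 1 - H ≤ 2 * l n := by omega
            exact_mod_cast this
          nlinarith
  have t2 : ∑ h ∈ (Finset.Ico H M).filter (fun h => ¬ h ≤ l n), a h ≤ 4 * C ^ 2 * η := by
    calc ∑ h ∈ (Finset.Ico H M).filter (fun h => ¬ h ≤ l n), a h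
        ≤ ∑ h ∈ (Finset.Ico H M).filter (fun h => ¬ h ≤ l n),
          4 * C ^ 2 * ((1 / p) ^ δ * mixingCoeff P X h ^ δ) := Finset.sum_le_sum fun h _ => bb h
      _ = 4 * C ^ 2 * ((1 / p) ^ δ * ∑ h ∈ (Finset.Ico H M).filter (fun h => ¬ h ≤ l n),
          mixingCoeff P X h ^ δ) := by rw [← Finset.mul_sum, ← Finset.mul_sum]
      _ ≤ 4 * C ^ 2 * η := by
          refine mul_le_mul_of_nonneg_left (s2 _ fun h hh => ?_) (by positivity)
          exact (not_le.1 (Finset.mem_filter.1 hh).2).le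
  have hfin : C ^ 2 * η * 12 = ε := by rw [hη]; field_simp
  have : 0 < C ^ 2 * η := by positivity
  nlinarith

/-- The normalized covariance at a fixed lag converges. -/
lemma tendsto_seriesCov_div (hX : ∀ t, Measurable (X t)) (hstat : IsStationary P X)
    (hRV : IsRegularlyVarying P N X κ μ) (hr : Tendsto r atTop atTop)
    (hf : Measurable f) (hg : Measurable g) (hfC : ∀ x, |f x| ≤ C)
    (hgC : ∀ x, |g x| ≤ C)
    (hfz : ∀ᶠ s in 𝓝 0, f s = 0) (hgz : ∀ᶠ s in 𝓝 0, g s = 0)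
    (hfd : marginalMeasure μ {x | ¬ ContinuousAt f x} = 0)
    (hgd : marginalMeasure μ {x | ¬ ContinuousAt g x} = 0)
    (hf0 : ∀ᶠ n in atTop, ∀ᵐ ω ∂P, ¬ r n < N (X 0 ω) → f (scaled (r n) (X 0 ω)) = 0)
    (hg0 : ∀ᶠ n in atTop, ∀ᵐ ω ∂P, ¬ r n < N (X 0 ω) → g (scaled (r n) (X 0 ω)) = 0) (h : ℕ) :
    Tendsto (fun n => seriesCov P X (fun x => f (scaled (r n) x)) (fun x => g (scaled (r n) x)) h /
      tailProb P N X (r n)) atTop (𝓝 (∫ s, f (s 0) * g (s (Fin.last h)) ∂(μ h))) := by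
  have t1 := (hRV.tendsto_pair hstat hX hf hg hfC hgC hfz hgz hfd hgd h).comp hr
  -- Each mean is `O(p)`, so their product is still `O(p)` after division by `p`.
  have t2 : Tendsto (fun n => ((∫ ω, f (scaled (r n) (X 0 ω)) ∂P) *
      ∫ ω, g (scaled (r n) (X 0 ω)) ∂P) / tailProb P N X (r n)) atTop (𝓝 0) := by
    have t3 := ((tendsto_tailProb (P := P) (N := N) hX).comp hr).const_mul (C ^ 2)
    rw [mul_zero] at t3
    refine squeeze_zero_norm' ?_ t3
    filter_upwards [hf0, hg0] with n hfn hgn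
    have hp := hRV.tailProb_pos (r n)
    have h2 := abs_integral_le_tailProb hX (hf.comp (measurable_scaled (r n))) (fun x => hfC _) hfn
    have h3 := abs_integral_le_tailProb hX (hg.comp (measurable_scaled (r n))) (fun x => hgC _) hgn
    have h4 := mul_le_mul h2 h3 (abs_nonneg _) ((abs_nonneg _).trans h2)
    rw [Real.norm_eq_abs, abs_div, abs_of_pos hp, div_le_iff₀ hp, abs_mul]
    refine h4.trans (le_of_eq ?_)
    simp only [Function.comp_apply]
    ring
  have := t1.sub t2
  rw [sub_zero] at this
  refine this.congr fun n => ?_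
  simp only [Function.comp_apply, seriesCov]
  rw [sub_div]

end Tail

end MixingTail
namespace MixingTail

/-! ### Choice of the block sizes -/

section BlockSizes

/-- The indices in the big blocks are distinct because `L ≤ m`, and they lie in `Icc 1 n` because `k
* m ≤ n`. What remains is a sum over their complement `A`, for which a variance bound in terms of
cardinality suffices. -/
lemma exists_sum_sub_blockSum_eq {Ω : Type*} {d : ℕ} (X : ℤ → Ω → Fin d → ℝ)
    (g : (Fin d → ℝ) → ℝ) {m L k n : ℕ} (hL : L ≤ m) (hk : k * m ≤ n) :
    ∃ A ⊆ Finset.range (n + 1), (A.card : ℝ) = n - k * L ∧ ∀ ω,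
      ∑ t ∈ Finset.Icc 1 n, g (X (t : ℤ) ω) - blockSum X g m L k ω = ∑ t ∈ A, g (X (t : ℤ) ω) := by
  set e : ℕ × ℕ → ℕ := fun q => q.1 * m + 1 + q.2 with he
  set B := (Finset.range k ×ˢ Finset.range L).image e with hB
  have hinj : Set.InjOn e (Finset.range k ×ˢ Finset.range L : Finset (ℕ × ℕ)) := by
    rintro ⟨j, t⟩ h1 ⟨j', t'⟩ h2 h
    simp only [Finset.coe_product, Set.mem_prod, Finset.mem_coe, Finset.mem_range] at h1 h2
    simp only [he] at h
    have hj : j = j' := by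
      by_contra hne
      rcases Nat.lt_or_gt_of_ne hne with hlt | hlt
      · have : (j + 1) * m ≤ j' * m := Nat.mul_le_mul_right _ hlt
        have h3 := h1.2
        nlinarith
      · have : (j' + 1) * m ≤ j * m := Nat.mul_le_mul_right _ hlt
        have h3 := h2.2
        nlinarith
    subst hj
    have : t = t' := by omega
    rw [this]
  have hBsub : B ⊆ Finset.Icc 1 n := by
    intro x hx
    obtain ⟨⟨j, t⟩, hq, rfl⟩ := Finset.mem_image.1 hx
    simp only [Finset.mem_product, Finset.mem_range] at hq
    have : (j + 1) * m ≤ k * m := Nat.mul_le_mul_right _ hq.1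
    have h3 := hq.2
    simp only [he, Finset.mem_Icc]
    constructor
    · omega
    · nlinarith
  have hcard : B.card = k * L := by
    rw [hB, Finset.card_image_of_injOn hinj, Finset.card_product, Finset.card_range,
      Finset.card_range]
  refine ⟨Finset.Icc 1 n \ B, ?_, ?_, fun ω => ?_⟩
  · intro x hx
    have := Finset.mem_Icc.1 (Finset.sdiff_subset hx)
    exact Finset.mem_range.2 (by omega)
  · rw [Finset.cast_card_sdiff hBsub, hcard, Nat.card_Icc]
    push_cast
    simp
  · rw [← Finset.sum_sdiff hBsub, hB, Finset.sum_image hinj, blockSum,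
      Finset.sum_product]
    simp [he]

lemma tendsto_inv_cube_div {p : ℕ → ℝ}
    (ho : (fun n : ℕ => (p n)⁻¹) =o[atTop] fun n : ℕ => (n : ℝ) ^ (1 / 3 : ℝ)) :
    Tendsto (fun n : ℕ => (p n)⁻¹ ^ 3 / n) atTop (𝓝 0) := by
  have h := (ho.tendsto_div_nhds_zero).pow 3
  rw [zero_pow three_ne_zero] at h
  refine h.congr fun n => ?_
  rw [div_pow, ← Real.rpow_natCast ((n : ℝ) ^ (1 / 3 : ℝ)), ← Real.rpow_mul (Nat.cast_nonneg n)]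
  norm_num

/-- The choice is `m = ⌈1 / p⌉`, `k = n / m`, `L = m - l`. A block length of order `1 / p` gives `k
≤ n * p`, as (iii) requires, while `l * p → 0` makes the gaps negligible. Natural subtraction
truncates, so `L + l ≤ m` holds only once `l ≤ m`. -/
lemma block_asymptotics {p : ℕ → ℝ} (hp : ∀ n, 0 < p n) (hp1 : ∀ n, p n ≤ 1)
    (hp0 : Tendsto p atTop (𝓝 0))
    (ho : (fun n : ℕ => (p n)⁻¹) =o[atTop] fun n : ℕ => (n : ℝ) ^ (1 / 3 : ℝ))
    {l : ℕ → ℕ} (hl : Tendsto (fun n => (l n : ℝ) * p n) atTop (𝓝 0)) :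
    ∃ m k L : ℕ → ℕ, (∀ᶠ n in atTop, L n + l n ≤ m n) ∧ (∀ n, L n ≤ m n) ∧
      (∀ n, k n * m n ≤ n) ∧
      (∀ n, (k n : ℝ) ≤ n * p n) ∧ Tendsto L atTop atTop ∧
      Tendsto (fun n => (k n : ℝ) * L n / n) atTop (𝓝 1) ∧
      Tendsto (fun n => (L n : ℝ) / √(n * p n)) atTop (𝓝 0) ∧
      Tendsto (fun n => (L n : ℝ) / n) atTop (𝓝 0) ∧
      Tendsto (fun n : ℕ => ((n : ℝ) * p n)⁻¹) atTop (𝓝 0) := by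
  have hu := tendsto_inv_cube_div ho
  set u : ℕ → ℝ := fun n => (p n)⁻¹ ^ 3 / n with hudef
  set m : ℕ → ℕ := fun n => ⌈(p n)⁻¹⌉₊ with hm
  set k : ℕ → ℕ := fun n => n / m n with hk
  set L : ℕ → ℕ := fun n => m n - l n with hLdef
  have hpi : ∀ n, 1 ≤ (p n)⁻¹ := fun n => (one_le_inv₀ (hp n)).2 (hp1 n)
  have hm1 : ∀ n, (p n)⁻¹ ≤ m n := fun n => Nat.le_ceil _
  have hm2 : ∀ n, (m n : ℝ) ≤ 2 * (p n)⁻¹ := fun n => by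
    have := (Nat.ceil_lt_add_one (inv_nonneg.2 (hp n).le)).le
    have := hpi n
    simp only [hm]
    linarith
  have hLm : ∀ n, L n ≤ m n := fun n => Nat.sub_le _ _
  have hkm : ∀ n, k n * m n ≤ n := fun n => Nat.div_mul_le_self _ _
  have hkp : ∀ n, (k n : ℝ) ≤ n * p n := fun n => by
    have h1 : (k n : ℝ) * m n ≤ n := by exact_mod_cast hkm n
    have h2 : (k n : ℝ) * (p n)⁻¹ ≤ n :=
      (mul_le_mul_of_nonneg_left (hm1 n) (Nat.cast_nonneg _)).trans h1
    rwa [← div_eq_mul_inv, div_le_iff₀ (hp n)] at h2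
  have hpinv : Tendsto (fun n => (p n)⁻¹) atTop atTop :=
    (tendsto_nhdsWithin_iff.2 ⟨hp0, Eventually.of_forall hp⟩).inv_tendsto_nhdsGT_zero
  have hlm : ∀ᶠ n in atTop, (l n : ℝ) ≤ (p n)⁻¹ / 2 := by
    filter_upwards [hl.eventually (gt_mem_nhds (by norm_num : (0 : ℝ) < 1 / 2))] with n hn
    rw [le_div_iff₀ two_pos, ← one_div, le_div_iff₀ (hp n)]
    linarith
  have hlm' : ∀ᶠ n in atTop, l n ≤ m n := hlm.mono fun n hn => by
    have : (l n : ℝ) ≤ m n := by linarith [hm1 n, hpi n]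
    exact_mod_cast this
  have hnp : Tendsto (fun n : ℕ => ((n : ℝ) * p n)⁻¹) atTop (𝓝 0) := by
    refine squeeze_zero (fun n => inv_nonneg.2 (mul_nonneg (Nat.cast_nonneg _) (hp n).le))
      (fun n => ?_) hu
    simp only [hudef]
    rw [mul_inv, mul_comm, ← div_eq_mul_inv]
    refine div_le_div_of_nonneg_right ?_ (Nat.cast_nonneg _)
    exact le_self_pow₀ (hpi n) three_ne_zero
  refine ⟨m, k, L, ?_, hLm, hkm, hkp, ?_, ?_, ?_, ?_, hnp⟩
  · exact hlm'.mono fun n hn => by simp only [hLdef]; omega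
  · refine tendsto_natCast_atTop_iff (R := ℝ).1 ?_
    refine tendsto_atTop_mono' _ ?_ (hpinv.atTop_div_const two_pos)
    filter_upwards [hlm, hlm'] with n h1 h2
    simp only [hLdef]
    rw [Nat.cast_sub h2]
    linarith [hm1 n]
  · have t : Tendsto (fun n : ℕ => 2 * ((n : ℝ) * p n)⁻¹ + l n * p n) atTop (𝓝 0) := by
      simpa using (hnp.const_mul 2).add hl
    have t2 : Tendsto (fun n : ℕ => 1 - (2 * ((n : ℝ) * p n)⁻¹ + l n * p n)) atTop (𝓝 1) := by
      simpa using t.const_sub 1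
    refine tendsto_of_tendsto_of_tendsto_of_le_of_le' t2 tendsto_const_nhds ?_ ?_
    · filter_upwards [hlm', eventually_gt_atTop 0] with n h2 hn
      have hn' : (0 : ℝ) < n := by exact_mod_cast hn
      rw [le_div_iff₀ hn']
      -- The remainder of the division of `n` by `m` leaves an incomplete block at the end, shorter
      -- than `m`.
      have h3 : (n : ℝ) ≤ k n * m n + m n := by
        have : n < m n * (k n + 1) := Nat.lt_mul_div_succ n (Nat.ceil_pos.2 (inv_pos.2 (hp n)))
        have h4 : n ≤ k n * m n + m n := by nlinarith
        exact_mod_cast h4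
      have e : (1 - (2 * ((n : ℝ) * p n)⁻¹ + l n * p n)) * n =
          n - 2 * (p n)⁻¹ - n * p n * l n := by
        have := (hp n).ne'
        field_simp
        ring
      rw [e]
      simp only [hLdef]
      rw [Nat.cast_sub h2]
      have h5 := mul_le_mul_of_nonneg_right (hkp n) (Nat.cast_nonneg (α := ℝ) (l n))
      linarith [hm2 n]
    · filter_upwards [eventually_gt_atTop 0] with n hn
      have hn' : (0 : ℝ) < n := by exact_mod_cast hn
      rw [div_le_one hn']
      have : k n * L n ≤ n := (Nat.mul_le_mul_left _ (hLm n)).trans (hkm n)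
      exact_mod_cast this
  -- Since `L ≤ 2 / p`, the ratio `L / √(n * p)` is at most twice the square root of `p⁻¹ ^ 3 / n`.
  -- This is where the exponent `1 / 3` is needed.
  · have t : Tendsto (fun n => 2 * √(u n)) atTop (𝓝 0) := by
      have := ((Real.continuous_sqrt.tendsto 0).comp hu).const_mul 2
      simpa using this
    refine squeeze_zero (fun n => by positivity) (fun n => ?_) t
    have h1 : (L n : ℝ) ≤ 2 * (p n)⁻¹ := le_trans (by exact_mod_cast hLm n) (hm2 n)
    have h2 : √(u n) = (p n)⁻¹ / √(n * p n) := by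
      have : u n = (p n)⁻¹ ^ 2 / (n * p n) := by
        simp only [hudef]
        have := (hp n).ne'
        by_cases hn : (n : ℝ) = 0
        · simp [hn]
        · field_simp
      rw [this, Real.sqrt_div (by positivity), Real.sqrt_sq (inv_nonneg.2 (hp n).le)]
    rw [h2, ← mul_div_assoc]
    exact div_le_div_of_nonneg_right h1 (Real.sqrt_nonneg _)
  · have t := hnp.const_mul 2
    rw [mul_zero] at t
    refine squeeze_zero (fun n => by positivity) (fun n => ?_) t
    have h1 : (L n : ℝ) ≤ 2 * (p n)⁻¹ := le_trans (by exact_mod_cast hLm n) (hm2 n)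
    refine (div_le_div_of_nonneg_right h1 (Nat.cast_nonneg _)).trans (le_of_eq ?_)
    rw [mul_inv, div_eq_mul_inv]
    ring

end BlockSizes

/-! ### The central limit theorem for one test function -/

section Scalar

variable {Ω : Type*} [MeasurableSpace Ω] {P : Measure Ω}
  {d : ℕ} {N : Seminorm ℝ (Fin d → ℝ)} {X : ℤ → Ω → Fin d → ℝ} {κ : ℝ}
  {μ : ∀ h : ℕ, Measure (Fin (h + 1) → ExtSpace d)} {r : ℕ → ℝ} {f g : ExtSpace d → ℝ}

/-- The test functions of the limit theorem: bounded measurable functions that vanish near `0` and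
almost surely below the thresholds, with negligible discontinuities. -/
structure IsTest (P : Measure Ω) (N : Seminorm ℝ (Fin d → ℝ)) (X : ℤ → Ω → Fin d → ℝ)
    (μ : ∀ h : ℕ, Measure (Fin (h + 1) → ExtSpace d)) (r : ℕ → ℝ) (f : ExtSpace d → ℝ) :
    Prop where
  measurable : Measurable f
  bounded : ∃ C : ℝ, ∀ x, |f x| ≤ C
  vanish : ∀ᶠ s in 𝓝 (0 : ExtSpace d), f s = 0
  ae_continuous : marginalMeasure μ {x | ¬ ContinuousAt f x} = 0
  ae_zero : ∀ᶠ n in atTop, ∀ᵐ ω ∂P, ¬ r n < N (X 0 ω) → f (scaled (r n) (X 0 ω)) = 0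

lemma IsTest.exists_common_bound (hf : IsTest P N X μ r f) (hg : IsTest P N X μ r g) :
    ∃ C : ℝ, 0 < C ∧ (∀ x, |f x| ≤ C) ∧ ∀ x, |g x| ≤ C := by
  obtain ⟨C, hC⟩ := hf.bounded
  obtain ⟨D, hD⟩ := hg.bounded
  have hC0 : 0 ≤ C := (abs_nonneg _).trans (hC 0)
  have hD0 : 0 ≤ D := (abs_nonneg _).trans (hD 0)
  exact ⟨C + D + 1, by linarith, fun x => by linarith [hC x], fun x => by linarith [hD x]⟩

lemma IsTest.const_mul (hf : IsTest P N X μ r f) (a : ℝ) :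
    IsTest P N X μ r (fun x => a * f x) where
  measurable := hf.measurable.const_mul a
  bounded := by
    obtain ⟨C, hC⟩ := hf.bounded
    exact ⟨|a| * C, fun x => by
      rw [abs_mul]; exact mul_le_mul_of_nonneg_left (hC x) (abs_nonneg _)⟩
  vanish := hf.vanish.mono fun s hs => by rw [hs, mul_zero]
  ae_continuous := by
    refine measure_mono_null (fun x (hx : ¬ ContinuousAt (fun x => a * f x) x) => ?_)
      hf.ae_continuous
    exact fun h => hx (continuousAt_const.mul h)
  ae_zero := hf.ae_zero.mono fun n hn => hn.mono fun ω hω h => by rw [hω h, mul_zero]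

lemma IsTest.add (hf : IsTest P N X μ r f) (hg : IsTest P N X μ r g) :
    IsTest P N X μ r (fun x => f x + g x) where
  measurable := hf.measurable.add hg.measurable
  bounded := by
    obtain ⟨C, -, hC, hD⟩ := hf.exists_common_bound hg
    exact ⟨C + C, fun x => (abs_add_le _ _).trans (add_le_add (hC x) (hD x))⟩
  vanish := by
    filter_upwards [hf.vanish, hg.vanish] with s h1 h2
    rw [h1, h2, add_zero]
  ae_continuous := by
    refine measure_mono_null (fun x (hx : ¬ ContinuousAt (fun x => f x + g x) x) => ?_)
      (measure_union_null hf.ae_continuous hg.ae_continuous)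
    by_contra hcon
    simp only [Set.mem_union, Set.mem_ofPred_eq, not_or, not_not] at hcon
    exact hx (hcon.1.add hcon.2)
  ae_zero := by
    filter_upwards [hf.ae_zero, hg.ae_zero] with n h1 h2
    filter_upwards [h1, h2] with ω hω1 hω2 h
    rw [hω1 h, hω2 h, add_zero]

/-- The integral of `(x, y) ↦ f x * g y` against the limit measure of `(X 0, X h)`. -/
noncomputable def blockCov (μ : ∀ h : ℕ, Measure (Fin (h + 1) → ExtSpace d)) (f g : ExtSpace d → ℝ)
    (h : ℕ) : ℝ :=
  ∫ s, f (s 0) * g (s (Fin.last h)) ∂(μ h)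

/-- The covariance of `f (X 0 / r)` and `g (X h / r)`, divided by the tail probability. -/
noncomputable def tailCov (P : Measure Ω) (N : Seminorm ℝ (Fin d → ℝ)) (X : ℤ → Ω → Fin d → ℝ)
    (f g : ExtSpace d → ℝ) (r : ℝ) (h : ℕ) : ℝ :=
  seriesCov P X (fun x => f (scaled r x)) (fun x => g (scaled r x)) h / tailProb P N X r

/-- The centered observation `f (x / r) - E f (X 0 / r)`. -/
noncomputable def centered (P : Measure Ω) (X : ℤ → Ω → Fin d → ℝ) (f : ExtSpace d → ℝ) (r : ℝ)
    (x : Fin d → ℝ) : ℝ :=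
  f (scaled r x) - ∫ ω, f (scaled r (X 0 ω)) ∂P

lemma measurable_centered (hf : Measurable f) (r : ℝ) : Measurable (centered P X f r) :=
  (hf.comp (measurable_scaled r)).sub_const _

variable [IsProbabilityMeasure P]

lemma IsTest.tendsto_tailCov (hf : IsTest P N X μ r f) (hg : IsTest P N X μ r g)
    (hX : ∀ t, Measurable (X t)) (hstat : IsStationary P X)
    (hRV : IsRegularlyVarying P N X κ μ) (hr : Tendsto r atTop atTop) (h : ℕ) :
    Tendsto (fun n => tailCov P N X f g (r n) h) atTop (𝓝 (blockCov μ f g h)) := by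
  obtain ⟨C, -, hfC, hgC⟩ := hf.exists_common_bound hg
  exact tendsto_seriesCov_div hX hstat hRV hr hf.measurable hg.measurable hfC hgC hf.vanish
    hg.vanish hf.ae_continuous hg.ae_continuous hf.ae_zero hg.ae_zero h

lemma IsTest.uniform_tail (hf : IsTest P N X μ r f) (hg : IsTest P N X μ r g)
    (hX : ∀ t, Measurable (X t)) (hstat : IsStationary P X)
    (hRV : IsRegularlyVarying P N X κ μ) (hM : ConditionM P N X r) :
    ∀ ε > 0, ∃ H, ∀ᶠ n in atTop, ∀ M, ∑ h ∈ Finset.Ico H M, |tailCov P N X f g (r n) h| ≤ ε := by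
  obtain ⟨C, hC, hfC, hgC⟩ := hf.exists_common_bound hg
  exact exists_tail_bound hX hstat hRV hM hf.measurable hg.measurable hC hfC hgC
    hf.ae_zero hg.ae_zero

lemma IsTest.summable_blockCov (hf : IsTest P N X μ r f) (hg : IsTest P N X μ r g)
    (hX : ∀ t, Measurable (X t)) (hstat : IsStationary P X)
    (hRV : IsRegularlyVarying P N X κ μ) (hr : Tendsto r atTop atTop)
    (hM : ConditionM P N X r) : Summable fun h => blockCov μ f g h :=
  summable_of_uniform_tail (hf.tendsto_tailCov hg hX hstat hRV hr)
    (hf.uniform_tail hg hX hstat hRV hM)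

lemma abs_centered_le {C : ℝ} (hC : ∀ x, |f x| ≤ C) (r : ℝ) (x : Fin d → ℝ) :
    |centered P X f r x| ≤ 2 * C := by
  have h1 : |∫ ω, f (scaled r (X 0 ω)) ∂P| ≤ C := by
    have := norm_integral_le_of_norm_le_const (μ := P) (f := fun ω => f (scaled r (X 0 ω)))
      (ae_of_all _ fun ω => hC _)
    simpa using this
  have := abs_sub (f (scaled r x)) (∫ ω, f (scaled r (X 0 ω)) ∂P)
  unfold centered
  linarith [hC (scaled r x)]

lemma integral_centered {C : ℝ} (hX : ∀ t, Measurable (X t)) (hf : Measurable f)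
    (hC : ∀ x, |f x| ≤ C) (r : ℝ) :
    ∫ ω, centered P X f r (X 0 ω) ∂P = 0 := by
  unfold centered
  have hm : Measurable fun ω => f (scaled r (X 0 ω)) :=
    hf.comp ((measurable_scaled r).comp (hX 0))
  rw [integral_sub (integrable_of_abs_le hm fun ω => hC _) (integrable_const _)]
  simp

lemma integral_sub_mul_sub {U W : Ω → ℝ} (hU : Integrable U P) (hW : Integrable W P)
    (hUW : Integrable (fun ω => U ω * W ω) P) (c : ℝ) :
    ∫ ω, (U ω - c) * (W ω - c) ∂P =
      ∫ ω, U ω * W ω ∂P - c * ∫ ω, U ω ∂P - c * ∫ ω, W ω ∂P + c * c := by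
  have e : ∀ ω, (U ω - c) * (W ω - c) = U ω * W ω - c * U ω - c * W ω + c * c := fun ω => by ring
  simp_rw [e]
  rw [integral_add (by fun_prop) (by fun_prop), integral_sub (by fun_prop) (by fun_prop),
    integral_sub (by fun_prop) (by fun_prop), integral_const_mul, integral_const_mul]
  simp

lemma integral_centered_mul {C : ℝ} (hX : ∀ t, Measurable (X t)) (hstat : IsStationary P X)
    (hf : Measurable f) (hC : ∀ x, |f x| ≤ C) {r : ℝ} (hp : 0 < tailProb P N X r) (h : ℕ) :
    ∫ ω, centered P X f r (X 0 ω) * centered P X f r (X (h : ℤ) ω) ∂P =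
      tailProb P N X r * tailCov P N X f f r h := by
  have hm : ∀ t, Measurable fun ω => f (scaled r (X t ω)) := fun t =>
    hf.comp ((measurable_scaled r).comp (hX t))
  have hi : ∀ t, Integrable (fun ω => f (scaled r (X t ω))) P := fun t =>
    integrable_of_abs_le (hm t) fun ω => hC _
  have hii : Integrable (fun ω => f (scaled r (X 0 ω)) * f (scaled r (X (h : ℤ) ω))) P :=
    integrable_of_abs_le ((hm 0).mul (hm h)) (C := C * C) fun ω => by
      rw [abs_mul]
      exact mul_le_mul (hC _) (hC _) (abs_nonneg _) ((abs_nonneg _).trans (hC 0))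
  have e : ∫ ω, f (scaled r (X (h : ℤ) ω)) ∂P = ∫ ω, f (scaled r (X 0 ω)) ∂P := by
    simpa using hstat.integral_comp hX (Φ := fun x => f (scaled r (x 0)))
      (hf.comp ((measurable_scaled r).comp (measurable_pi_apply _))) (h : ℤ)
  rw [tailCov, mul_div_cancel₀ _ hp.ne', seriesCov]
  unfold centered
  set c := ∫ ω, f (scaled r (X 0 ω)) ∂P with hc
  rw [integral_sub_mul_sub (hi 0) (hi h) hii, e, ← hc]
  ring

lemma integral_sum_centered_sq_le {C : ℝ} (hX : ∀ t, Measurable (X t))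
    (hstat : IsStationary P X) (hf : Measurable f) (hC : ∀ x, |f x| ≤ C) {r : ℝ}
    (hp : 0 < tailProb P N X r) {M : ℕ} {A : Finset ℕ} (hA : A ⊆ Finset.range M) :
    ∫ ω, (∑ t ∈ A, centered P X f r (X (t : ℤ) ω)) ^ 2 ∂P ≤
      A.card * (2 * (tailProb P N X r * ∑ h ∈ Finset.range M, |tailCov P N X f f r h|)) := by
  refine (integral_sum_sq_le hstat hX (measurable_centered hf r) (abs_centered_le hC r) hA).trans
    (le_of_eq ?_)
  rw [Finset.mul_sum (a := tailProb P N X r)]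
  congr 3
  ext h
  rw [integral_centered_mul hX hstat hf hC hp h, abs_mul, abs_of_pos hp]

lemma integral_sum_range_centered_sq {C : ℝ} (hX : ∀ t, Measurable (X t))
    (hstat : IsStationary P X) (hf : Measurable f) (hC : ∀ x, |f x| ≤ C) {r : ℝ}
    (hp : 0 < tailProb P N X r) {L : ℕ} (hL : 0 < L) :
    ∫ ω, (∑ t ∈ Finset.range L, centered P X f r (X (t : ℤ) ω)) ^ 2 ∂P =
      L * tailProb P N X r * (tailCov P N X f f r 0 + 2 * ∑ h ∈ Finset.range L,
        (1 - ((h : ℝ) + 1) / L) * tailCov P N X f f r (h + 1)) := by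
  rw [integral_sum_range_sq hstat hX (measurable_centered hf r) (abs_centered_le hC r)]
  simp_rw [integral_centered_mul hX hstat hf hC hp]
  have := integral_centered_mul (N := N) hX hstat hf hC hp 0
  simp only [Nat.cast_zero] at this
  rw [this]
  have hL' : (L : ℝ) ≠ 0 := by exact_mod_cast hL.ne'
  have e : ∀ h : ℕ, ((L : ℝ) - (h + 1)) * (tailProb P N X r * tailCov P N X f f r (h + 1)) =
      (L * tailProb P N X r) * ((1 - ((h : ℝ) + 1) / L) * tailCov P N X f f r (h + 1)) := by
    intro h
    field_simp
  simp_rw [e]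
  rw [← Finset.mul_sum]
  ring

/-- The normalized block variances converge. -/
lemma IsTest.tendsto_blockVariance (hf : IsTest P N X μ r f)
    (hX : ∀ t, Measurable (X t)) (hstat : IsStationary P X)
    (hRV : IsRegularlyVarying P N X κ μ) (hr : Tendsto r atTop atTop)
    (hM : ConditionM P N X r) {L : ℕ → ℕ} (hL : Tendsto L atTop atTop) :
    Tendsto (fun n => tailCov P N X f f (r n) 0 + 2 * ∑ h ∈ Finset.range (L n),
        (1 - ((h : ℝ) + 1) / L n) * tailCov P N X f f (r n) (h + 1)) atTop
      (𝓝 (blockCov μ f f 0 + 2 * ∑' h, blockCov μ f f (h + 1))) := by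
  refine (hf.tendsto_tailCov hf hX hstat hRV hr 0).add (Tendsto.const_mul 2 ?_)
  have hLr : Tendsto (fun n => (L n : ℝ)) atTop atTop := tendsto_natCast_atTop_iff.2 hL
  -- Truncation at zero keeps the weights in `[0, 1]` at lags beyond `L n` as well, where the
  -- uniform tail bound must also hold; it changes nothing within the range of summation.
  set w : ℕ → ℕ → ℝ := fun n h => max 0 (1 - ((h : ℝ) + 1) / L n) with hw
  have hw1 : ∀ n h, |w n h| ≤ 1 := fun n h => by
    have : 0 ≤ ((h : ℝ) + 1) / L n := by positivity
    rw [abs_of_nonneg (le_max_left _ _)]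
    exact max_le zero_le_one (by linarith)
  have key := tendsto_sum_of_uniform_tail
    (b := fun n h => w n h * tailCov P N X f f (r n) (h + 1))
    (c := fun h => blockCov μ f f (h + 1)) (M := L) (fun h => ?_) ?_ hL
  · refine key.congr fun n => Finset.sum_congr rfl fun h hh => ?_
    have hh' : (h : ℝ) + 1 ≤ L n := by exact_mod_cast Finset.mem_range.1 hh
    have : 0 ≤ 1 - ((h : ℝ) + 1) / L n := by
      rw [sub_nonneg]
      exact div_le_one_of_le₀ hh' (Nat.cast_nonneg _)
    simp only [hw]
    rw [max_eq_right this]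
  · have t1 : Tendsto (fun n => w n h) atTop (𝓝 1) := by
      have t2 : Tendsto (fun n => 1 - ((h : ℝ) + 1) / L n) atTop (𝓝 (1 - 0)) :=
        (hLr.const_div_atTop _).const_sub 1
      have t3 := (tendsto_const_nhds (x := (0 : ℝ))).max t2
      simpa using t3
    simpa using t1.mul (hf.tendsto_tailCov hf hX hstat hRV hr (h + 1))
  · intro ε hε
    obtain ⟨H, hH⟩ := hf.uniform_tail hf hX hstat hRV hM ε hε
    refine ⟨H, hH.mono fun n hn M => ?_⟩
    refine le_trans ?_ (hn (M + 1))
    calc ∑ h ∈ Finset.Ico H M, |w n h * tailCov P N X f f (r n) (h + 1)|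
        ≤ ∑ h ∈ Finset.Ico H M, |tailCov P N X f f (r n) (h + 1)| :=
          Finset.sum_le_sum fun h _ => by
            rw [abs_mul]; exact mul_le_of_le_one_left (abs_nonneg _) (hw1 n h)
      _ = ∑ h ∈ Finset.Ico (H + 1) (M + 1), |tailCov P N X f f (r n) h| :=
          Finset.sum_Ico_add' (fun h => |tailCov P N X f f (r n) h|) H M 1
      _ ≤ ∑ h ∈ Finset.Ico H (M + 1), |tailCov P N X f f (r n) h| :=
          Finset.sum_le_sum_of_subset_of_nonneg (Finset.Ico_subset_Ico_left (Nat.le_succ _))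
            fun _ _ _ => abs_nonneg _

/-- The normalized covariances are uniformly absolutely summable over the lags, so the variance of a
sum is at most of order `p` per term, whatever the set of indices. This serves both for the
discarded terms and for the weak law. -/
lemma IsTest.exists_variance_bound (hf : IsTest P N X μ r f)
    (hX : ∀ t, Measurable (X t)) (hstat : IsStationary P X)
    (hRV : IsRegularlyVarying P N X κ μ) (hr : Tendsto r atTop atTop)
    (hM : ConditionM P N X r) :
    ∃ K, 0 < K ∧ ∀ᶠ n in atTop, ∀ M : ℕ, ∀ A ⊆ Finset.range M,
      ∫ ω, (∑ t ∈ A, centered P X f (r n) (X (t : ℤ) ω)) ^ 2 ∂P ≤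
        A.card * (K * tailProb P N X (r n)) := by
  obtain ⟨K, hK0, hK⟩ := exists_bound_of_uniform_tail (hf.tendsto_tailCov hf hX hstat hRV hr)
    (hf.uniform_tail hf hX hstat hRV hM)
  obtain ⟨C, hC⟩ := hf.bounded
  refine ⟨2 * K, by positivity, hK.mono fun n hn M A hA => ?_⟩
  have hp := hRV.tailProb_pos (r n)
  refine (integral_sum_centered_sq_le hX hstat hf.measurable hC hp hA).trans ?_
  refine mul_le_mul_of_nonneg_left ?_ (Nat.cast_nonneg _)
  have := mul_le_mul_of_nonneg_left (hn M) hp.le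
  linarith

/-- The limit theorem for one test function, in terms of characteristic functions. -/
lemma IsTest.tendsto_charFun (hf : IsTest P N X μ r f)
    (hX : ∀ t, Measurable (X t)) (hstat : IsStationary P X)
    (hRV : IsRegularlyVarying P N X κ μ) (hr : Tendsto r atTop atTop)
    (hM : ConditionM P N X r) :
    0 ≤ blockCov μ f f 0 + 2 * ∑' h, blockCov μ f f (h + 1) ∧
    Tendsto (fun n : ℕ => ∫ ω, Complex.exp (Complex.I * ((√(n * tailProb P N X (r n)))⁻¹ *
        ∑ t ∈ Finset.Icc 1 n, centered P X f (r n) (X (t : ℤ) ω) : ℝ)) ∂P) atTop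
      (𝓝 (Real.exp (-(blockCov μ f f 0 + 2 * ∑' h, blockCov μ f f (h + 1)) / 2) : ℂ)) := by
  obtain ⟨K, hK0, hK⟩ := hf.exists_variance_bound hX hstat hRV hr hM
  obtain ⟨ho, l, hl, hlp, -, -, hiii⟩ := id hM
  obtain ⟨C, hC0, hC, -⟩ := hf.exists_common_bound hf
  set p : ℕ → ℝ := fun n => tailProb P N X (r n) with hpdef
  have hp : ∀ n, 0 < p n := fun n => hRV.tailProb_pos (r n)
  have hp0 : Tendsto p atTop (𝓝 0) := (tendsto_tailProb (P := P) (N := N) hX).comp hr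
  obtain ⟨m, k, L, hLl, hLm, hkm, hkp, hL, hkL, hLs, hLn, hnp⟩ :=
    block_asymptotics hp (fun n => measureReal_le_one) hp0 ho hlp
  set σ := blockCov μ f f 0 + 2 * ∑' h, blockCov μ f f (h + 1) with hσ
  set V : ℕ → ℝ := fun n => tailCov P N X f f (r n) 0 + 2 * ∑ h ∈ Finset.range (L n),
        (1 - ((h : ℝ) + 1) / L n) * tailCov P N X f f (r n) (h + 1) with hV
  have hVt : Tendsto V atTop (𝓝 σ) := hf.tendsto_blockVariance hX hstat hRV hr hM hL
  have hVvar : ∀ᶠ n in atTop, ∫ ω, (∑ t ∈ Finset.range (L n),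
      centered P X f (r n) (X (t : ℤ) ω)) ^ 2 ∂P = L n * p n * V n := by
    filter_upwards [hL.eventually_gt_atTop 0] with n hn
    exact integral_sum_range_centered_sq hX hstat hf.measurable hC (hp n) hn
  -- `V n` is the variance of a block divided by a positive number.
  have hσ0 : 0 ≤ σ := by
    refine ge_of_tendsto hVt ?_
    filter_upwards [hVvar, hL.eventually_gt_atTop 0] with n hn hLpos
    have h1 : 0 ≤ L n * p n * V n := by rw [← hn]; exact integral_nonneg fun ω => sq_nonneg _
    exact nonneg_of_mul_nonneg_right h1 (mul_pos (by exact_mod_cast hLpos) (hp n))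
  refine ⟨hσ0, ?_⟩
  set c : ℕ → ℝ := fun n => (√(n * p n))⁻¹ with hc
  have hcsq : ∀ n, c n ^ 2 = ((n : ℝ) * p n)⁻¹ := fun n => by
    simp only [hc]
    rw [inv_pow, Real.sq_sqrt (mul_nonneg (Nat.cast_nonneg _) (hp n).le)]
  -- The variance of one block after division by `√(n * p n)`: the factors `p n` cancel.
  set v : ℕ → ℝ := fun n => (L n : ℝ) / n * V n with hv
  have hvt : Tendsto v atTop (𝓝 0) := by simpa using hLn.mul hVt
  have hkv : Tendsto (fun n => k n * v n) atTop (𝓝 σ) := by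
    have := hkL.mul hVt
    rw [one_mul] at this
    refine this.congr fun n => ?_
    simp only [hv]
    ring
  -- In this order: the terms outside the big blocks, the decoupling of the blocks, and the Gaussian
  -- replacement.
  set E : ℕ → ℝ := fun n => √(K * (1 - (k n : ℝ) * L n / n)) +
    16 * (n * p n * mixingCoeff P X (l n)) +
    (2 * C * (L n / √(n * p n)) * (k n * v n) + k n * v n * v n) with hE
  have hEt : Tendsto E atTop (𝓝 0) := by
    have t1 : Tendsto (fun n => √(K * (1 - (k n : ℝ) * L n / n))) atTop (𝓝 0) := by
      have := (Real.continuous_sqrt.tendsto _).comp ((hkL.const_sub 1).const_mul K)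
      rw [sub_self, mul_zero, Real.sqrt_zero] at this
      exact this
    have t2 := hiii.const_mul 16
    have t3 := ((hLs.const_mul (2 * C)).mul hkv).add (hkv.mul hvt)
    have := (t1.add t2).add t3
    simp only [mul_zero, zero_mul, add_zero] at this
    exact this
  have hexp : Tendsto (fun n => (Real.exp (-(k n * v n) / 2) : ℂ)) atTop
      (𝓝 (Real.exp (-σ / 2) : ℂ)) := by
    have : Tendsto (fun n => Real.exp (-(k n * v n) / 2)) atTop (𝓝 (Real.exp (-σ / 2))) :=
      (Real.continuous_exp.tendsto _).comp (hkv.neg.div_const 2)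
    exact (Complex.continuous_ofReal.tendsto _).comp this
  have hdiff : Tendsto (fun n => ∫ ω, Complex.exp (Complex.I * (c n *
        ∑ t ∈ Finset.Icc 1 n, centered P X f (r n) (X (t : ℤ) ω) : ℝ)) ∂P -
        (Real.exp (-(k n * v n) / 2) : ℂ)) atTop (𝓝 0) := by
    refine squeeze_zero_norm' ?_ hEt
    -- The Taylor expansion requires a normalized block sum to be bounded by 1.
    have hsmall := (hLs.const_mul (2 * C)).eventually
      (gt_mem_nhds (show 2 * C * 0 < (1 : ℝ) by simp))
    filter_upwards [hLl, hVvar, hK, hsmall, eventually_gt_atTop 0] with n h1 h2 h3 h4 hn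
    have hn' : (0 : ℝ) < n := by exact_mod_cast hn
    have hpn := hp n
    set Y := centered P X f (r n) with hY
    have hYm : Measurable Y := measurable_centered hf.measurable (r n)
    have hc0 : 0 ≤ c n := inv_nonneg.2 (Real.sqrt_nonneg _)
    have main := norm_integral_cexp_sum_sub_le hstat hX (g := fun x => c n * Y x)
      (hYm.const_mul _) (b := c n * (2 * C)) (fun x => by
        rw [abs_mul, abs_of_nonneg hc0]
        exact mul_le_mul_of_nonneg_left (abs_centered_le hC (r n) x) hc0)
      (by rw [integral_const_mul, integral_centered hX hf.measurable hC, mul_zero])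
      (n := n) (k := k n) h1 (by
        refine le_trans (le_of_eq ?_) h4.le
        simp only [hc]
        ring)
    have e1 : ∫ ω, (∑ t ∈ Finset.range (L n), c n * Y (X (t : ℤ) ω)) ^ 2 ∂P = v n := by
      simp_rw [← Finset.mul_sum, mul_pow]
      rw [integral_const_mul, h2, hcsq]
      simp only [hv]
      field_simp
    obtain ⟨A, hA, hAc, hAs⟩ := exists_sum_sub_blockSum_eq X (fun x => c n * Y x) (hLm n) (hkm n)
    have e2 : ∫ ω, (∑ t ∈ Finset.Icc 1 n, c n * Y (X (t : ℤ) ω) -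
        blockSum X (fun x => c n * Y x) (m n) (L n) (k n) ω) ^ 2 ∂P ≤
        K * (1 - (k n : ℝ) * L n / n) := by
      simp_rw [hAs, ← Finset.mul_sum, mul_pow]
      rw [integral_const_mul, hcsq]
      have := mul_le_mul_of_nonneg_left (h3 (n + 1) A hA)
        (inv_nonneg.2 (mul_nonneg hn'.le hpn.le))
      refine this.trans (le_of_eq ?_)
      rw [hAc]
      change ((n : ℝ) * p n)⁻¹ * ((n - k n * L n) * (K * p n)) = _
      field_simp
    rw [e1] at main
    simp_rw [← Finset.mul_sum] at main e2
    refine main.trans ?_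
    refine add_le_add (add_le_add (Real.sqrt_le_sqrt e2) ?_) (le_of_eq ?_)
    · rw [mul_assoc]
      exact mul_le_mul_of_nonneg_left (mul_le_mul_of_nonneg_right (hkp n)
        (mixingCoeff_nonneg P X _)) (by norm_num)
    · simp only [hc]
      ring
  have := hdiff.add hexp
  rw [zero_add] at this
  exact this.congr fun n => sub_add_cancel _ _

end Scalar

end MixingTail
namespace MixingTail

/-! ### The limiting covariances -/

section Covariances

variable {Ω : Type*} [MeasurableSpace Ω] {P : Measure Ω}
  {d : ℕ} {N : Seminorm ℝ (Fin d → ℝ)} {X : ℤ → Ω → Fin d → ℝ} {κ : ℝ}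
  {μ : ∀ h : ℕ, Measure (Fin (h + 1) → ExtSpace d)} {r : ℕ → ℝ} {f g : ExtSpace d → ℝ}

/-- If `N (X 0 ω) < r n`, the scaled vector lies in the open unit ball by homogeneity of `N`. The
boundary case `N (X 0 ω) = r n` is the one that `hsphere` excludes. -/
lemma isTest_of_vanish (hr : Tendsto r atTop atTop) (hf : Measurable f)
    (hb : ∃ C : ℝ, ∀ x, |f x| ≤ C)
    (hball : ∀ x : Fin d → ℝ, N x < 1 → f (fun j => (x j : EReal)) = 0)
    (hsphere : ∀ᶠ n in atTop, P {ω | N (X 0 ω) = r n ∧ f (scaled (r n) (X 0 ω)) ≠ 0} = 0)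
    (hdisc : marginalMeasure μ {x | ¬ ContinuousAt f x} = 0) : IsTest P N X μ r f where
  measurable := hf
  bounded := hb
  vanish := eventually_eq_zero hball
  ae_continuous := hdisc
  ae_zero := by
    filter_upwards [hsphere, hr.eventually_gt_atTop 0] with n hn hrn
    have : ∀ᵐ ω ∂P, ¬ (N (X 0 ω) = r n ∧ f (scaled (r n) (X 0 ω)) ≠ 0) := by
      rw [ae_iff]; simpa using hn
    filter_upwards [this] with ω hω hle
    by_contra hne
    rcases (not_lt.1 hle).lt_or_eq with hlt | heq
    · refine hne (hball (fun j => X 0 ω j / r n) ?_)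
      have e : (fun j => X 0 ω j / r n) = (r n)⁻¹ • X 0 ω := by
        ext j; simp [div_eq_inv_mul]
      rw [e, map_smul_eq_mul, Real.norm_eq_abs, abs_of_pos (inv_pos.2 hrn), inv_mul_lt_iff₀ hrn,
        mul_one]
      exact hlt
    · exact hω ⟨heq, hne⟩

lemma IsTest.integrable_block (hf : IsTest P N X μ r f) (hg : IsTest P N X μ r g)
    (hRV : IsRegularlyVarying P N X κ μ) (h : ℕ) :
    Integrable (fun s => f (s 0) * g (s (Fin.last h))) (μ h) := by
  obtain ⟨C, -, hC, hD⟩ := hf.exists_common_bound hg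
  exact integrable_pair_block hRV hf.measurable hg.measurable hC hD hf.vanish h

lemma IsTest.integrable_pairMeasure (hf : IsTest P N X μ r f) (hg : IsTest P N X μ r g)
    (hRV : IsRegularlyVarying P N X κ μ) (h : ℕ) :
    Integrable (fun z => f z.1 * g z.2) (pairMeasure μ h) :=
  integrable_pairMeasure_of ((hf.measurable.comp measurable_fst).mul
    (hg.measurable.comp measurable_snd)) (hf.integrable_block hg hRV h)

lemma IsTest.lagCov_eq (hf : IsTest P N X μ r f) (hg : IsTest P N X μ r g)
    (hRV : IsRegularlyVarying P N X κ μ) (h : ℕ) :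
    lagCov μ f g h = (blockCov μ f g h + blockCov μ g f h) / 2 := by
  have m1 := hf.measurable
  have m2 := hg.measurable
  rw [lagCov, integral_pairMeasure (by fun_prop), integral_div,
    integral_add (hf.integrable_block hg hRV h) (hg.integrable_block hf hRV h)]
  · rfl
  · simp [hf.vanish.self_of_nhds, hg.vanish.self_of_nhds]

/-- The limit measure of the pair need not be symmetric, so the two mixed terms may differ. Only
their sum occurs, which is why the symmetrized `lagCov` is the right covariance. -/
lemma IsTest.blockCov_linear (hf : IsTest P N X μ r f) (hg : IsTest P N X μ r g)
    (hRV : IsRegularlyVarying P N X κ μ) (a b : ℝ) (h : ℕ) :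
    blockCov μ (fun x => a * f x + b * g x) (fun x => a * f x + b * g x) h =
      a ^ 2 * blockCov μ f f h + a * b * (blockCov μ f g h + blockCov μ g f h) +
        b ^ 2 * blockCov μ g g h := by
  have e : ∀ s : Fin (h + 1) → ExtSpace d, (a * f (s 0) + b * g (s 0)) *
      (a * f (s (Fin.last h)) + b * g (s (Fin.last h))) =
      a ^ 2 * (f (s 0) * f (s (Fin.last h))) + a * b * (f (s 0) * g (s (Fin.last h)) +
        g (s 0) * f (s (Fin.last h))) + b ^ 2 * (g (s 0) * g (s (Fin.last h))) := fun s => by ring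
  have i1 := hf.integrable_block hf hRV h
  have i2 := hf.integrable_block hg hRV h
  have i3 := hg.integrable_block hf hRV h
  have i4 := hg.integrable_block hg hRV h
  unfold blockCov
  simp_rw [e]
  have i23 : Integrable (fun s => f (s 0) * g (s (Fin.last h)) + g (s 0) * f (s (Fin.last h)))
      (μ h) := i2.add i3
  have i123 : Integrable (fun s => a ^ 2 * (f (s 0) * f (s (Fin.last h))) +
      a * b * (f (s 0) * g (s (Fin.last h)) + g (s 0) * f (s (Fin.last h)))) (μ h) :=
    (i1.const_mul _).add (i23.const_mul _)
  rw [integral_add i123 (i4.const_mul _),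
    integral_add (i1.const_mul _) (i23.const_mul _), integral_const_mul,
    integral_const_mul, integral_const_mul, integral_add i2 i3]

variable [IsProbabilityMeasure P]

lemma IsTest.summable_lagCov (hf : IsTest P N X μ r f) (hg : IsTest P N X μ r g)
    (hX : ∀ t, Measurable (X t)) (hstat : IsStationary P X)
    (hRV : IsRegularlyVarying P N X κ μ) (hr : Tendsto r atTop atTop)
    (hM : ConditionM P N X r) : Summable fun h => lagCov μ f g (h + 1) := by
  simp_rw [hf.lagCov_eq hg hRV]
  exact (((hf.summable_blockCov hg hX hstat hRV hr hM).add
    (hg.summable_blockCov hf hX hstat hRV hr hM)).div_const 2).comp_injective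
    (add_left_injective 1)

/-- The limiting variance of a linear combination of two test functions. -/
lemma IsTest.blockCov_linear_sum (hf : IsTest P N X μ r f) (hg : IsTest P N X μ r g)
    (hX : ∀ t, Measurable (X t)) (hstat : IsStationary P X)
    (hRV : IsRegularlyVarying P N X κ μ) (hr : Tendsto r atTop atTop)
    (hM : ConditionM P N X r) (a b : ℝ) :
    blockCov μ (fun x => a * f x + b * g x) (fun x => a * f x + b * g x) 0 +
      2 * ∑' h, blockCov μ (fun x => a * f x + b * g x) (fun x => a * f x + b * g x) (h + 1) =
      a ^ 2 * limitCov μ f f + a * b * (limitCov μ f g + limitCov μ g f) +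
        b ^ 2 * limitCov μ g g := by
  have e : ∀ h, blockCov μ (fun x => a * f x + b * g x) (fun x => a * f x + b * g x) h =
      a ^ 2 * lagCov μ f f h + a * b * (lagCov μ f g h + lagCov μ g f h) +
        b ^ 2 * lagCov μ g g h := by
    intro h
    rw [hf.blockCov_linear hg hRV, hf.lagCov_eq hf hRV, hf.lagCov_eq hg hRV,
      hg.lagCov_eq hf hRV, hg.lagCov_eq hg hRV]
    ring
  have s1 := hf.summable_lagCov hf hX hstat hRV hr hM
  have s2 := hf.summable_lagCov hg hX hstat hRV hr hM
  have s3 := hg.summable_lagCov hf hX hstat hRV hr hM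
  have s4 := hg.summable_lagCov hg hX hstat hRV hr hM
  simp_rw [e]
  rw [((s1.mul_left (a ^ 2)).add ((s2.add s3).mul_left (a * b))).tsum_add (s4.mul_left (b ^ 2)),
    (s1.mul_left (a ^ 2)).tsum_add ((s2.add s3).mul_left (a * b)), tsum_mul_left, tsum_mul_left,
    tsum_mul_left, s2.tsum_add s3]
  unfold limitCov
  ring

end Covariances

/-! ### The vector limit theorem and the weak law -/

section Vector

variable {Ω : Type*} [MeasurableSpace Ω] {P : Measure Ω}
  {d : ℕ} {N : Seminorm ℝ (Fin d → ℝ)} {X : ℤ → Ω → Fin d → ℝ} {κ : ℝ}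
  {μ : ∀ h : ℕ, Measure (Fin (h + 1) → ExtSpace d)} {r : ℕ → ℝ}
  {f : Fin 2 → ExtSpace d → ℝ}

lemma centeredSum_apply (n : ℕ) (ω : Ω) (i : Fin 2) :
    centeredSum P X r f n ω i =
      ∑ t ∈ Finset.Icc 1 n, centered P X (f i) (r n) (X (t : ℤ) ω) := rfl

lemma measurable_centeredSum (hX : ∀ t, Measurable (X t)) (hf : ∀ i, Measurable (f i)) (n : ℕ) :
    Measurable (centeredSum P X r f n) := by
  refine (WithLp.measurable_toLp 2 (Fin 2 → ℝ)).comp (measurable_pi_lambda _ fun i => ?_)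
  exact Finset.measurable_fun_sum _ fun t _ => (measurable_centered (hf i) (r n)).comp (hX t)

variable [IsProbabilityMeasure P]

lemma centered_linear {g₀ g₁ : ExtSpace d → ℝ} (hX : ∀ t, Measurable (X t))
    (h₀ : IsTest P N X μ r g₀) (h₁ : IsTest P N X μ r g₁) (a b s : ℝ) (x : Fin d → ℝ) :
    centered P X (fun x => a * g₀ x + b * g₁ x) s x =
      a * centered P X g₀ s x + b * centered P X g₁ s x := by
  obtain ⟨C, -, hC, hD⟩ := h₀.exists_common_bound h₁
  have i0 : Integrable (fun ω => g₀ (scaled s (X 0 ω))) P := integrable_of_abs_le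
    (h₀.measurable.comp ((measurable_scaled s).comp (hX 0))) fun ω => hC _
  have i1 : Integrable (fun ω => g₁ (scaled s (X 0 ω))) P := integrable_of_abs_le
    (h₁.measurable.comp ((measurable_scaled s).comp (hX 0))) fun ω => hD _
  unfold centered
  rw [integral_add (i0.const_mul a) (i1.const_mul b), integral_const_mul, integral_const_mul]
  ring

lemma dotProduct_limitCovMatrix (x : Fin 2 → ℝ) :
    x ⬝ᵥ (limitCovMatrix μ f).mulVec x =
      x 0 ^ 2 * limitCov μ (f 0) (f 0) +
        x 0 * x 1 * (limitCov μ (f 0) (f 1) + limitCov μ (f 1) (f 0)) +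
        x 1 ^ 2 * limitCov μ (f 1) (f 1) := by
  simp only [dotProduct, Matrix.mulVec, Fin.sum_univ_two, limitCovMatrix, Matrix.of_apply]
  ring

/-- The quadratic form at `x` is the limiting variance for the test function `x 0 * f 0 + x 1 * f
1`, and a limit of variances is nonnegative. -/
lemma posSemidef_limitCovMatrix (hf : ∀ i, IsTest P N X μ r (f i))
    (hX : ∀ t, Measurable (X t)) (hstat : IsStationary P X)
    (hRV : IsRegularlyVarying P N X κ μ) (hr : Tendsto r atTop atTop)
    (hM : ConditionM P N X r) : (limitCovMatrix μ f).PosSemidef := by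
  refine Matrix.PosSemidef.of_dotProduct_mulVec_nonneg ?_ fun x => ?_
  · ext i j
    simp only [Matrix.conjTranspose_apply, limitCovMatrix, Matrix.of_apply, star_trivial, limitCov]
    have : ∀ h, lagCov μ (f j) (f i) h = lagCov μ (f i) (f j) h := fun h => by
      rw [(hf j).lagCov_eq (hf i) hRV, (hf i).lagCov_eq (hf j) hRV, add_comm]
    simp_rw [this]
  · rw [star_trivial, dotProduct_limitCovMatrix,
      ← (hf 0).blockCov_linear_sum (hf 1) hX hstat hRV hr hM]
    exact ((((hf 0).const_mul _).add ((hf 1).const_mul _)).tendsto_charFun hX hstat hRV hr hM).1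

/-- By Lévy's continuity theorem. The characteristic function at `t` is the scalar one for `t 0 * f
0 + t 1 * f 1`, since centering is linear in the test function; `dotProduct_limitCovMatrix` matches
its limit variance with the Gaussian exponent. -/
lemma tendstoInDistribution_centeredSum (hf : ∀ i, IsTest P N X μ r (f i))
    (hX : ∀ t, Measurable (X t)) (hstat : IsStationary P X)
    (hRV : IsRegularlyVarying P N X κ μ) (hr : Tendsto r atTop atTop)
    (hM : ConditionM P N X r) :
    TendstoInDistribution
      (fun (n : ℕ) ω => (√(n * tailProb P N X (r n)))⁻¹ • centeredSum P X r f n ω)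
      atTop id (fun _ => P) (multivariateGaussian 0 (limitCovMatrix μ f)) where
  forall_aemeasurable n :=
    (Measurable.fun_const_smul (measurable_centeredSum hX (fun i => (hf i).measurable) n)
      _).aemeasurable
  tendsto := by
    refine ProbabilityMeasure.tendsto_iff_tendsto_charFun.2 fun t => ?_
    have hS := posSemidef_limitCovMatrix hf hX hstat hRV hr hM
    have key := ((((hf 0).const_mul (t 0)).add ((hf 1).const_mul (t 1))).tendsto_charFun hX hstat
      hRV hr hM).2
    rw [(hf 0).blockCov_linear_sum (hf 1) hX hstat hRV hr hM, ← dotProduct_limitCovMatrix] at key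
    have e : charFun (Measure.map id (multivariateGaussian 0 (limitCovMatrix μ f))) t =
        (Real.exp (-(t.ofLp ⬝ᵥ (limitCovMatrix μ f).mulVec t.ofLp) / 2) : ℂ) := by
      rw [Measure.map_id, charFun_multivariateGaussian hS, inner_zero_right, Complex.ofReal_exp]
      congr 1
      push_cast
      ring
    simp only [ProbabilityMeasure.coe_mk]
    rw [e]
    refine key.congr fun n => ?_
    have hZ : Measurable fun ω =>
        (√(n * tailProb P N X (r n)))⁻¹ • centeredSum P X r f n ω :=
      Measurable.fun_const_smul (measurable_centeredSum hX (fun i => (hf i).measurable) n) _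
    rw [charFun_apply, integral_map hZ.aemeasurable (by fun_prop)]
    refine integral_congr_ae (ae_of_all _ fun ω => ?_)
    simp only
    rw [mul_comm Complex.I]
    congr 3
    rw [real_inner_smul_left, PiLp.inner_apply, Fin.sum_univ_two]
    simp only [centeredSum_apply, RCLike.inner_apply, conj_trivial]
    congr 1
    rw [Finset.mul_sum, Finset.mul_sum, ← Finset.sum_add_distrib]
    exact Finset.sum_congr rfl fun s _ => centered_linear hX (hf 0) (hf 1) _ _ _ _

/-- Each coordinate of the normalized sum has second moment at most `n * K * p / (n * p) ^ 2 = K /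
(n * p)`, which tends to zero. Hence the coordinates tend to zero in L¹, and Markov's inequality
concludes. -/
lemma tendstoInMeasure_centeredSum (hf : ∀ i, IsTest P N X μ r (f i))
    (hX : ∀ t, Measurable (X t)) (hstat : IsStationary P X)
    (hRV : IsRegularlyVarying P N X κ μ) (hr : Tendsto r atTop atTop)
    (hM : ConditionM P N X r) :
    TendstoInMeasure P
      (fun (n : ℕ) ω => ((n : ℝ) * tailProb P N X (r n))⁻¹ • centeredSum P X r f n ω)
      atTop (fun _ => 0) := by
  obtain ⟨ho, l, -, hlp, -⟩ := id hM
  have hp : ∀ n, 0 < tailProb P N X (r n) := fun n => hRV.tailProb_pos (r n)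
  obtain ⟨-, -, -, -, -, -, -, -, -, -, -, hnp⟩ := block_asymptotics hp
    (fun n => measureReal_le_one) ((tendsto_tailProb (P := P) (N := N) hX).comp hr) ho hlp
  have hcoord : ∀ i, Tendsto (fun n : ℕ => ∫ ω, |((n : ℝ) * tailProb P N X (r n))⁻¹ *
      centeredSum P X r f n ω i| ∂P) atTop (𝓝 0) := by
    intro i
    obtain ⟨K, hK0, hK⟩ := (hf i).exists_variance_bound hX hstat hRV hr hM
    obtain ⟨C, hC⟩ := (hf i).bounded
    have t : Tendsto (fun n : ℕ => √(K * ((n : ℝ) * tailProb P N X (r n))⁻¹)) atTop (𝓝 0) := by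
      have := (Real.continuous_sqrt.tendsto _).comp (hnp.const_mul K)
      rw [mul_zero, Real.sqrt_zero] at this
      exact this
    refine squeeze_zero' (Eventually.of_forall fun n => integral_nonneg fun ω => abs_nonneg _)
      ?_ t
    filter_upwards [hK, eventually_gt_atTop 0] with n hn hn0
    have hn' : (0 : ℝ) < n := by exact_mod_cast hn0
    have hpn := hp n
    set c := ((n : ℝ) * tailProb P N X (r n))⁻¹ with hc
    have hc0 : 0 ≤ c := inv_nonneg.2 (mul_nonneg hn'.le hpn.le)
    have hm : Measurable fun ω => c * centeredSum P X r f n ω i := by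
      simp_rw [centeredSum_apply]
      refine Measurable.const_mul (Finset.measurable_fun_sum _ fun t _ => ?_) c
      exact (measurable_centered (hf i).measurable (r n)).comp (hX t)
    refine (integral_abs_le_sqrt hm (C := c * (n * (2 * C))) fun ω => ?_).trans
      (Real.sqrt_le_sqrt ?_)
    · rw [abs_mul, abs_of_nonneg hc0, centeredSum_apply]
      refine mul_le_mul_of_nonneg_left ((Finset.abs_sum_le_sum_abs _ _).trans ?_) hc0
      refine (Finset.sum_le_sum fun t _ => abs_centered_le hC (r n) _).trans ?_
      simp
    · simp_rw [mul_pow, centeredSum_apply]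
      rw [integral_const_mul]
      have hA : Finset.Icc 1 n ⊆ Finset.range (n + 1) := fun x hx =>
        Finset.mem_range.2 (by have := Finset.mem_Icc.1 hx; omega)
      refine (mul_le_mul_of_nonneg_left (hn (n + 1) _ hA) (sq_nonneg c)).trans (le_of_eq ?_)
      rw [Nat.card_Icc, Nat.add_sub_cancel, hc]
      field_simp
  rw [tendstoInMeasure_iff_measureReal_norm]
  intro ε hε
  have hsum := ((hcoord 0).add (hcoord 1)).div_const ε
  rw [add_zero, zero_div] at hsum
  refine squeeze_zero (fun n => measureReal_nonneg) (fun n => ?_) hsum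
  set c := ((n : ℝ) * tailProb P N X (r n))⁻¹ with hc
  set Z : Fin 2 → Ω → ℝ := fun i ω => c * centeredSum P X r f n ω i with hZ
  have hZi : ∀ i, Integrable (Z i) P := fun i => by
    obtain ⟨C, hC⟩ := (hf i).bounded
    simp only [hZ, centeredSum_apply]
    refine Integrable.const_mul (integrable_finsetSum _ fun t _ => ?_) c
    exact integrable_of_abs_le ((measurable_centered (hf i).measurable (r n)).comp (hX t))
      fun ω => abs_centered_le hC (r n) _
  -- The Euclidean norm is at most the sum of the absolute values of the coordinates.
  have hsub : {ω | ε ≤ ‖c • centeredSum P X r f n ω - 0‖} ⊆ {ω | ε ≤ |Z 0 ω| + |Z 1 ω|} := by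
    intro ω hω
    refine le_trans (b := ‖c • centeredSum P X r f n ω - 0‖) hω ?_
    rw [sub_zero, EuclideanSpace.norm_eq, Fin.sum_univ_two]
    apply Real.sqrt_le_iff.2
    refine ⟨by positivity, ?_⟩
    simp only [PiLp.smul_apply, smul_eq_mul, Real.norm_eq_abs]
    have := mul_nonneg (abs_nonneg (Z 0 ω)) (abs_nonneg (Z 1 ω))
    simp only [hZ] at this ⊢
    nlinarith
  refine (measureReal_mono hsub).trans ?_
  have := mul_meas_ge_le_integral_of_nonneg (μ := P) (f := fun ω => |Z 0 ω| + |Z 1 ω|)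
    (ae_of_all _ fun ω => by positivity) ((hZi 0).abs.add (hZi 1).abs) ε
  rw [integral_add (hZi 0).abs (hZi 1).abs] at this
  rw [le_div_iff₀ hε, mul_comm]
  exact this

end Vector

end MixingTail

theorem lemma1 {Ω : Type*} [MeasurableSpace Ω] (P : Measure Ω) [IsProbabilityMeasure P]
    {d : ℕ} (N : Seminorm ℝ (Fin d → ℝ)) (hN : ∀ x, N x = 0 → x = 0)
    (X : ℤ → Ω → Fin d → ℝ) (hX : ∀ t, Measurable (X t))
    (hstat : MixingTail.IsStationary P X)
    (κ : ℝ) (μ : ∀ h : ℕ, Measure (Fin (h + 1) → MixingTail.ExtSpace d))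
    (hRV : MixingTail.IsRegularlyVarying P N X κ μ)
    (hmix : Tendsto (MixingTail.mixingCoeff P X) atTop (𝓝 0))
    (r : ℕ → ℝ) (hr : Tendsto r atTop atTop)
    (hM : MixingTail.ConditionM P N X r)
    (f : Fin 2 → MixingTail.ExtSpace d → ℝ)
    (hfmeas : ∀ i, Measurable (f i))
    (hfbdd : ∀ i, ∃ C : ℝ, ∀ x, |f i x| ≤ C)
    (hfball : ∀ i, ∀ x : Fin d → ℝ, N x < 1 → f i (fun j => (x j : EReal)) = 0)
    (hfsphere : ∀ i, ∀ᶠ n in atTop,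
      P {ω | N (X 0 ω) = r n ∧ f i (MixingTail.scaled (r n) (X 0 ω)) ≠ 0} = 0)
    (hfdisc : ∀ i, MixingTail.marginalMeasure μ {x | ¬ ContinuousAt (f i) x} = 0) :
    (∀ i j, ∀ h : ℕ, Integrable (fun z => f i z.1 * f j z.2) (MixingTail.pairMeasure μ h)) ∧
    (∀ i j, Summable fun h : ℕ => MixingTail.lagCov μ (f i) (f j) (h + 1)) ∧
    (MixingTail.limitCovMatrix μ f).PosSemidef ∧
    TendstoInDistribution
      (fun (n : ℕ) ω => (Real.sqrt (n * MixingTail.tailProb P N X (r n)))⁻¹ •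
        MixingTail.centeredSum P X r f n ω)
      atTop id (fun _ => P)
      (multivariateGaussian 0 (MixingTail.limitCovMatrix μ f)) ∧
    TendstoInMeasure P
      (fun (n : ℕ) ω => ((n : ℝ) * MixingTail.tailProb P N X (r n))⁻¹ •
        MixingTail.centeredSum P X r f n ω)
      atTop (fun _ => 0) := by
  have hf : ∀ i, MixingTail.IsTest P N X μ r (f i) := fun i =>
    MixingTail.isTest_of_vanish hr (hfmeas i) (hfbdd i) (hfball i) (hfsphere i) (hfdisc i)
  exact ⟨fun i j h => (hf i).integrable_pairMeasure (hf j) hRV h,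
    fun i j => (hf i).summable_lagCov (hf j) hX hstat hRV hr hM,
    MixingTail.posSemidef_limitCovMatrix hf hX hstat hRV hr hM,
    MixingTail.tendstoInDistribution_centeredSum hf hX hstat hRV hr hM,
    MixingTail.tendstoInMeasure_centeredSum hf hX hstat hRV hr hM⟩
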